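/- Consider two groups of spins of sizes $N_1,N_2$, with $N=N_1+N_2$, and a symmetric real coupling matrix $J=(J_{\lambda\mu})_{\lambda,\mu=1,2}$. The spin configuration $X=(X_{\lambda i})\in\{-1,1\}^{N}$ has the law $$\mathbb P(X=x)=Z^{-1}\exp\Big(\frac1{2N}\sum_{\lambda,\mu=1}^{2}J_{\lambda\mu}\sum_{i=1}^{N_\lambda}\sum_{j=1}^{N_\mu}x_{\lambda i}x_{\mu j}\Big),$$ where $Z$ is the normalisation constant, and $S_\lambda=\sum_{i=1}^{N_\lambda}X_{\lambda i}$. Let the group sizes vary along a sequence such that $N_1,N_2\to\infty$ and $N_\lambda/N\to\alpha_\lambda$ with $\alpha_1,\alpha_2\neq0$. Write $\Longrightarrow$ for weak convergence along this sequence, and for $\eta>0$ let $\nu_\eta$ be the probability measure on $\mathbb R$ whose density is proportional to $\exp(-\eta x^4)$. (1) Homogeneous coupling, critical regime: let $J_{\lambda\mu}=1$ for all $\lambda,\mu$. If $N^{1/4}(N_\lambda/N-\alpha_\lambda)\to0$ for $\lambda=1,2$, then $$\frac{\sqrt{\alpha_2/\alpha_1}\,S_1-\sqrt{\alpha_1/\alpha_2}\,S_2}{\sqrt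 N}\Longrightarrow\mathcal N(0,1).$$ Without this condition on the rate, $$\frac{S_1}{2(\alpha_1N_1^3)^{1/4}}+\frac{S_2}{2(\alpha_2N_2^3)^{1/4}}\Longrightarrow\nu_{1/12}.$$ (2) Heterogeneous coupling, critical regime: let $J$ be positive definite, and let $J^{-1}-\mathrm{diag}(\alpha_1,\alpha_2)$ be positive semi-definite but not positive definite. Write $L_\lambda=(J^{-1})_{\lambda\lambda}$, and assume $L_1-\alpha_1>0$ and $L_2-\alpha_2>0$ (equivalently, in this regime, $J_{12}\neq0$). Let $\sigma=\operatorname{sgn}(J_{12})\in\{-1,1\}$. If $\sqrt N\,(N_\lambda/N-\alpha_\lambda)\to0$ for $\lambda=1,2$, then $$\frac{\sqrt{L_1-\alpha_1}}{\sqrt{\alpha_1N_1}}S_1-\sigma\frac{\sqrt{L_2-\alpha_2}}{\sqrt{\alpha_2N_2}}S_2\Longrightarrow\mathcal N\Big(0,\,1+\frac{L_1-\alpha_1}{\alpha_1}+\frac{L_2-\alpha_2}{\alpha_2}\Big)$$ and $$\frac{\sqrt{L_1-\alpha_1}}{(\alpha_1N_1^3)^{1/4}}S_1+\sigma\frac{\sqrt{L_2-\alpha_2}}{(\alpha_2N_2^3)^{1/4}}S_2\Longrightarrow\nu_\eta,\qquad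 \eta=\frac1{2^6\cdot3}\Big(\frac{\alpha_1}{(L_1-\alpha_1)^2}+\frac{\alpha_2}{(L_2-\alpha_2)^2}\Big).$$ -/

import Mathlib

open MeasureTheory ProbabilityTheory Filter Topology

noncomputable section

namespace CurieWeiss

/-- Spin configurations of `M` groups of sizes `N k`; a spin is an element of `ℤˣ = {1, -1}`. -/
def Config {M : ℕ} (N : Fin M → ℕ) : Type := (k : Fin M) → Fin (N k) → ℤˣ

instance {M : ℕ} (N : Fin M → ℕ) : Fintype (Config N) :=
  inferInstanceAs (Fintype ((k : Fin M) → Fin (N k) → ℤˣ))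

instance {M : ℕ} (N : Fin M → ℕ) : Nonempty (Config N) :=
  inferInstanceAs (Nonempty ((k : Fin M) → Fin (N k) → ℤˣ))

instance {M : ℕ} (N : Fin M → ℕ) : MeasurableSpace (Config N) := ⊤

/-- The total number of spins. -/
def total {M : ℕ} (N : Fin M → ℕ) : ℕ := ∑ k, N k

/-- The value `±1` of the `i`-th spin of group `k`, as a real number. -/
def spin {M : ℕ} {N : Fin M → ℕ} (x : Config N) (k : Fin M) (i : Fin (N k)) : ℝ :=
  ((x k i : ℤ) : ℝ)

/-- The Hamiltonian of the multi-group model with coupling matrix `J`. -/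
def hamiltonian {M : ℕ} {N : Fin M → ℕ} (J : Matrix (Fin M) (Fin M) ℝ) (x : Config N) : ℝ :=
  -(1 / (2 * (total N : ℝ))) *
    ∑ k, ∑ l, J k l * ∑ i : Fin (N k), ∑ j : Fin (N l), spin x k i * spin x l j

/-- The normalisation constant `Z`. -/
def partitionFunction {M : ℕ} (N : Fin M → ℕ) (J : Matrix (Fin M) (Fin M) ℝ) : ℝ :=
  ∑ x : Config N, Real.exp (-hamiltonian J x)

/-- The canonical ensemble: the configuration `x` has probability `Z⁻¹ exp (-H x)`. -/
def gibbs {M : ℕ} (N : Fin M → ℕ) (J : Matrix (Fin M) (Fin M) ℝ) : Measure (Config N) :=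
  ∑ x : Config N,
    ENNReal.ofReal ((partitionFunction N J)⁻¹ * Real.exp (-hamiltonian J x)) • Measure.dirac x

theorem partitionFunction_pos {M : ℕ} (N : Fin M → ℕ) (J : Matrix (Fin M) (Fin M) ℝ) :
    0 < partitionFunction N J :=
  Finset.sum_pos (fun _ _ => Real.exp_pos _) Finset.univ_nonempty

instance {M : ℕ} (N : Fin M → ℕ) (J : Matrix (Fin M) (Fin M) ℝ) :
    IsProbabilityMeasure (gibbs N J) := by
  constructor
  have h := partitionFunction_pos N J
  simp only [gibbs, Measure.finsetSum_apply, Measure.smul_apply, measure_univ, smul_eq_mul,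
    mul_one]
  rw [← ENNReal.ofReal_sum_of_nonneg (fun x _ => by positivity), ← Finset.mul_sum]
  change ENNReal.ofReal ((partitionFunction N J)⁻¹ * partitionFunction N J) = 1
  rw [inv_mul_cancel₀ h.ne', ENNReal.ofReal_one]

/-- The magnetisation `S k` of group `k`. -/
def magnetisation {M : ℕ} {N : Fin M → ℕ} (k : Fin M) (x : Config N) : ℝ :=
  ∑ i : Fin (N k), spin x k i

/-- The homogeneous coupling matrix, all of whose entries are `β`.
Its critical regime is `β = 1`. -/
def homogeneousCoupling (M : ℕ) (β : ℝ) : Matrix (Fin M) (Fin M) ℝ := Matrix.of fun _ _ => β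

/-- The critical regime of heterogeneous coupling matrices: `J` is positive definite (in
particular symmetric), and `J⁻¹ - diag α` is positive semi-definite but not positive definite. -/
structure HeterogeneousCritical {M : ℕ} (α : Fin M → ℝ) (J : Matrix (Fin M) (Fin M) ℝ) :
    Prop where
  nonneg : ∀ k, 0 ≤ α k
  sum_eq_one : ∑ k, α k = 1
  posDef : J.PosDef
  posSemidef : (J⁻¹ - Matrix.diagonal α).PosSemidef
  not_posDef : ¬ (J⁻¹ - Matrix.diagonal α).PosDef

/-- The measure on `ℝ` whose density is `exp (-η x ^ 4)` divided by its integral. -/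
def quarticLaw (η : ℝ) : Measure ℝ := volume.tilted fun x => -(η * x ^ 4)

theorem isProbabilityMeasure_quarticLaw {η : ℝ} (hη : 0 < η) :
    IsProbabilityMeasure (quarticLaw η) := by
  refine isProbabilityMeasure_tilted ?_
  refine ((integrable_exp_neg_mul_sq hη).mul_const (Real.exp η)).mono'
    (by fun_prop) (Eventually.of_forall fun x => ?_)
  rw [Real.norm_of_nonneg (Real.exp_pos _).le, ← Real.exp_add]
  apply Real.exp_le_exp.2
  nlinarith [mul_nonneg hη.le (sq_nonneg (x ^ 2 - 1)), mul_nonneg hη.le (sq_nonneg x)]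

/-- The random variables `X n`, defined on the probability spaces `(Ω n, P n)`, converge in
distribution to the probability measure `ν`, that is, their laws converge weakly to `ν`. -/
def ConvergesInLaw {Ω : ℕ → Type} [∀ n, MeasurableSpace (Ω n)] (P : (n : ℕ) → Measure (Ω n))
    [∀ n, IsProbabilityMeasure (P n)] (X : (n : ℕ) → Ω n → ℝ) (ν : Measure ℝ) : Prop :=
  ∃ _ : IsProbabilityMeasure ν, TendstoInDistribution X atTop (id : ℝ → ℝ) P ν

end CurieWeiss

end

namespace CurieWeiss

/-! ### Elementary bounds on hyperbolic functions -/

/-! Both couplings have the form `k kᵀ / A + g gᵀ / D`. Here `k` is the critical direction with `∑ α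
k² = A`, `g` is orthogonal to `k` for the weights `α`, and `D = 1 + ∑ α g²`. The homogeneous model
has `k = 1`, `g = 0`. Put `s = N^(1/4)`. Linearising the two squares in the Gibbs weight by Gaussian
integrals over `u` and `v` makes the spins independent, in the fields `m i = (k i u + g i v / s) /
s`. The characteristic function of `∑ b i S i` is then a quotient of two planar integrals
(`charFun_map_gibbs`).

Write `log cosh m = m²/2 - coshDefect m`. At criticality the quadratic part cancels `s² A u² / 2`
and turns `D v² / 2` into `v² / 2`, while the defects tend to `u⁴ ∑ α k⁴ / 12`. So `u` becomes
quartic and `v` standard normal. A lower bound on the defect that is quadratic at infinity supplies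
domination (`eventually_hsExponent_le`).

The statistic shifts the fields by `i c`, with `c = t b`, and `cosh (m + i c) / cosh m = cos c + i
tanh m sin c` has `N`-th power close to `exp (i N c tanh m - N c² / 2)`. The limit is thus the law
of `p u + q v` plus independent Gaussian noise of variance `∑ κ`, where `p`, `q`, `κ` are limits of
explicit sums in `b` (`tendsto_charFun`). Normal limits are the case `p = 0`, quartic ones `κ = q =
0`, `p = 1`.

The density error enters the exponent multiplied by `s² = √N`, whence the rate in the heterogeneous
case. In the homogeneous case it cancels, as densities sum to one, and only `p = 0` requires the
rate `N^(1/4)`.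

For heterogeneous `J`, degeneracy gives `J⁻¹ = diag α + h hᵀ`; `k` is orthogonal to `h`, and `g` is
normalised by `h · g = 1` (`HeterogeneousCritical.eq_rankTwoCoupling`). -/

theorem le_of_hasDerivAt_le {f g f' g' : ℝ → ℝ} (hf : ∀ x, HasDerivAt f (f' x) x)
    (hg : ∀ x, HasDerivAt g (g' x) x) (h0 : f 0 ≤ g 0) (h : ∀ x, 0 ≤ x → f' x ≤ g' x)
    {x : ℝ} (hx : 0 ≤ x) : f x ≤ g x := by
  have hd : ∀ y, HasDerivAt (fun z => g z - f z) (g' y - f' y) y := fun y => (hg y).sub (hf y)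
  have hm : MonotoneOn (fun z => g z - f z) (Set.Ici 0) := by
    refine monotoneOn_of_deriv_nonneg (convex_Ici 0)
      (fun y _ => (hd y).continuousAt.continuousWithinAt)
      (fun y _ => (hd y).differentiableAt.differentiableWithinAt) fun y hy => ?_
    rw [interior_Ici] at hy
    rw [(hd y).deriv]
    exact sub_nonneg.2 (h y (le_of_lt hy))
  have := hm Set.self_mem_Ici (Set.mem_Ici.2 hx) hx
  simp only at this
  linarith

theorem hasDerivAt_tanh (x : ℝ) : HasDerivAt Real.tanh (1 - Real.tanh x ^ 2) x := by
  have hc := (Real.cosh_pos x).ne'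
  have h := (Real.hasDerivAt_sinh x).div (Real.hasDerivAt_cosh x) hc
  have he : (Real.sinh / Real.cosh : ℝ → ℝ) = Real.tanh := by
    ext y; simp [Real.tanh_eq_sinh_div_cosh]
  rw [he] at h
  refine h.congr_deriv ?_
  rw [Real.tanh_eq_sinh_div_cosh]
  field_simp

theorem continuous_tanh : Continuous Real.tanh :=
  continuous_iff_continuousAt.2 fun x => (hasDerivAt_tanh x).continuousAt

theorem hasDerivAt_log_cosh (x : ℝ) :
    HasDerivAt (fun y => Real.log (Real.cosh y)) (Real.tanh x) x := by
  rw [Real.tanh_eq_sinh_div_cosh]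
  exact (Real.hasDerivAt_cosh x).log (Real.cosh_pos x).ne'

theorem tanh_nonneg {x : ℝ} (hx : 0 ≤ x) : 0 ≤ Real.tanh x := by
  rw [Real.tanh_eq_sinh_div_cosh]
  exact div_nonneg (Real.sinh_nonneg_iff.2 hx) (Real.cosh_pos x).le

theorem tanh_le_self {x : ℝ} (hx : 0 ≤ x) : Real.tanh x ≤ x :=
  le_of_hasDerivAt_le hasDerivAt_tanh hasDerivAt_id (by simp)
    (fun y _ => by nlinarith [sq_nonneg (Real.tanh y)]) hx

theorem sub_cube_le_tanh {x : ℝ} (hx : 0 ≤ x) : x - x ^ 3 / 3 ≤ Real.tanh x := by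
  refine le_of_hasDerivAt_le (f := fun x => x - x ^ 3 / 3) (f' := fun x => 1 - x ^ 2)
    (fun y => ?_) hasDerivAt_tanh (by simp)
    (fun y hy => ?_) hx
  · refine HasDerivAt.congr_deriv ((hasDerivAt_id' y).sub ((hasDerivAt_pow 3 y).div_const 3)) ?_
    push_cast; ring
  · nlinarith [tanh_le_self hy, tanh_nonneg hy]

theorem tanh_le_quintic {x : ℝ} (hx : 0 ≤ x) :
    Real.tanh x ≤ x - x ^ 3 / 3 + 2 * x ^ 5 / 15 := by
  refine le_of_hasDerivAt_le (g := fun x => x - x ^ 3 / 3 + 2 * x ^ 5 / 15)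
    (g' := fun x => 1 - x ^ 2 + 2 * x ^ 4 / 3) hasDerivAt_tanh
    (fun y => ?_) (by simp) (fun y hy => ?_) hx
  · refine HasDerivAt.congr_deriv (((hasDerivAt_id' y).sub ((hasDerivAt_pow 3 y).div_const 3)).add
      (((hasDerivAt_pow 5 y).const_mul 2).div_const 15)) ?_
    push_cast; ring
  · have h1 := sub_cube_le_tanh hy
    have h0 := tanh_nonneg hy
    have h2 : y ^ 2 - 2 * y ^ 4 / 3 ≤ Real.tanh y ^ 2 := by
      rcases le_total 0 (y - y ^ 3 / 3) with h | h
      · have := pow_le_pow_left₀ h h1 2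
        nlinarith [sq_nonneg (y ^ 3)]
      -- Squaring the cubic bound is useless where it is negative, but there the left side is itself
      -- nonpositive.
      · have h4 : y ^ 2 ≤ y ^ 4 / 3 := by nlinarith [mul_nonpos_of_nonneg_of_nonpos hy h]
        nlinarith [sq_nonneg (Real.tanh y), sq_nonneg (y ^ 2)]
    linarith

/-- A consequence of `exp (2 x) ≥ 1 + 2 x`. Unlike the Taylor bounds it stays useful for large `x`.
-/
theorem div_one_add_le_tanh {x : ℝ} (hx : 0 ≤ x) : x / (1 + x) ≤ Real.tanh x := by
  have h : 0 < 1 + x := by linarith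
  have h1 : 2 * x + 1 ≤ Real.exp (2 * x) := Real.add_one_le_exp _
  have h2 : Real.exp (2 * x) = Real.exp x * Real.exp x := by rw [← Real.exp_add]; ring_nf
  have h3 : Real.exp x * Real.exp (-x) = 1 := by rw [← Real.exp_add]; simp
  have h4 := Real.exp_pos x
  have h5 := Real.exp_pos (-x)
  rw [Real.tanh_eq_sinh_div_cosh, Real.sinh_eq, Real.cosh_eq, div_le_div_iff₀ h (by positivity)]
  have h6 : (2 * x + 1) * Real.exp (-x) ≤ Real.exp x := by
    calc (2 * x + 1) * Real.exp (-x) ≤ Real.exp (2 * x) * Real.exp (-x) := by gcongr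
      _ = Real.exp x := by rw [h2, mul_assoc, h3, mul_one]
  nlinarith

theorem tanh_le_sub_cube_div {x : ℝ} (hx : 0 ≤ x) :
    Real.tanh x ≤ x - x ^ 3 / (6 * (1 + x ^ 2)) := by
  refine le_of_hasDerivAt_le
    (g := fun x => x - x ^ 3 / (6 * (1 + x ^ 2)))
    (g' := fun x => 1 - (3 * x ^ 2 + x ^ 4) / (6 * (1 + x ^ 2) ^ 2)) hasDerivAt_tanh
    (fun y => ?_) (by simp) (fun y hy => ?_) hx
  · have hne : 6 * (1 + y ^ 2) ≠ 0 := by positivity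
    refine HasDerivAt.congr_deriv ((hasDerivAt_id' y).sub ((hasDerivAt_pow 3 y).div
      (((hasDerivAt_pow 2 y).const_add 1).const_mul 6) hne)) ?_
    push_cast
    field_simp
    ring
  · have h1 : (y / (1 + y)) ^ 2 ≤ Real.tanh y ^ 2 :=
      pow_le_pow_left₀ (by positivity) (div_one_add_le_tanh hy) 2
    have h2 : (3 * y ^ 2 + y ^ 4) / (6 * (1 + y ^ 2) ^ 2) ≤ (y / (1 + y)) ^ 2 := by
      rw [div_pow, div_le_div_iff₀ (by positivity) (by positivity)]
      have h3 : (1 + y) ^ 2 ≤ 2 * (1 + y ^ 2) := by nlinarith [sq_nonneg (1 - y)]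
      calc (3 * y ^ 2 + y ^ 4) * (1 + y) ^ 2
          ≤ (3 * y ^ 2 + 3 * y ^ 4) * (2 * (1 + y ^ 2)) := by gcongr; nlinarith [sq_nonneg (y ^ 2)]
        _ = y ^ 2 * (6 * (1 + y ^ 2) ^ 2) := by ring
    linarith

theorem abs_tanh_sub_self_le (x : ℝ) : |Real.tanh x - x| ≤ |x| ^ 3 / 3 := by
  wlog hx : 0 ≤ x generalizing x
  · have := this (-x) (by linarith)
    rwa [Real.tanh_neg, abs_neg, show -Real.tanh x - -x = -(Real.tanh x - x) by ring,
      abs_neg] at this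
  · rw [abs_of_nonneg hx, abs_le]
    constructor <;> linarith [sub_cube_le_tanh hx, tanh_le_self hx, pow_nonneg hx 3]

/-- The defect in the inequality `log (cosh x) ≤ x ^ 2 / 2`. -/
noncomputable def coshDefect (x : ℝ) : ℝ := x ^ 2 / 2 - Real.log (Real.cosh x)

theorem coshDefect_neg (x : ℝ) : coshDefect (-x) = coshDefect x := by simp [coshDefect]

theorem coshDefect_zero : coshDefect 0 = 0 := by simp [coshDefect]

theorem hasDerivAt_coshDefect (x : ℝ) : HasDerivAt coshDefect (x - Real.tanh x) x := by
  refine (((hasDerivAt_pow 2 x).div_const 2).sub (hasDerivAt_log_cosh x)).congr_deriv ?_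
  push_cast; ring

theorem cosh_eq_exp (x : ℝ) : Real.cosh x = Real.exp (x ^ 2 / 2 - coshDefect x) := by
  rw [coshDefect, sub_sub_cancel, Real.exp_log (Real.cosh_pos x)]

theorem coshDefect_le (x : ℝ) : coshDefect x ≤ x ^ 4 / 12 := by
  wlog hx : 0 ≤ x generalizing x
  · simpa [coshDefect_neg, Even.neg_pow (by decide : Even 4)] using this (-x) (by linarith)
  refine le_of_hasDerivAt_le (g := fun x => x ^ 4 / 12) (g' := fun x => x ^ 3 / 3)
    hasDerivAt_coshDefect (fun y => ?_)
    (by simp [coshDefect_zero]) (fun y hy => by linarith [sub_cube_le_tanh hy]) hx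
  refine HasDerivAt.congr_deriv ((hasDerivAt_pow 4 y).div_const 12) ?_
  push_cast; ring

theorem le_coshDefect (x : ℝ) : x ^ 4 / 12 - x ^ 6 / 45 ≤ coshDefect x := by
  wlog hx : 0 ≤ x generalizing x
  · simpa [coshDefect_neg, Even.neg_pow (by decide : Even 4), Even.neg_pow (by decide : Even 6)]
      using this (-x) (by linarith)
  refine le_of_hasDerivAt_le (f := fun x => x ^ 4 / 12 - x ^ 6 / 45)
    (f' := fun x => x ^ 3 / 3 - 2 * x ^ 5 / 15) (fun y => ?_)
    hasDerivAt_coshDefect (by simp [coshDefect_zero])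
    (fun y hy => by linarith [tanh_le_quintic hy]) hx
  refine HasDerivAt.congr_deriv (((hasDerivAt_pow 4 y).div_const 12).sub ((hasDerivAt_pow 6 y).div_const 45)) ?_
  push_cast; ring

/-- Quartic near zero and quadratic at infinity, hence valid globally; this is what the domination
needs, since the Taylor bound becomes negative for large `x`. -/
theorem div_le_coshDefect (x : ℝ) : x ^ 4 / (24 * (1 + x ^ 2)) ≤ coshDefect x := by
  wlog hx : 0 ≤ x generalizing x
  · simpa [coshDefect_neg, Even.neg_pow (by decide : Even 4)] using this (-x) (by linarith)
  refine le_of_hasDerivAt_le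
    (f := fun x => x ^ 4 / (24 * (1 + x ^ 2)))
    (f' := fun x => (4 * x ^ 3 + 2 * x ^ 5) / (24 * (1 + x ^ 2) ^ 2)) (fun y => ?_)
    hasDerivAt_coshDefect (by simp [coshDefect_zero]) (fun y hy => ?_) hx
  · have hne : 24 * (1 + y ^ 2) ≠ 0 := by positivity
    refine HasDerivAt.congr_deriv ((hasDerivAt_pow 4 y).div (((hasDerivAt_pow 2 y).const_add 1).const_mul 24) hne) ?_
    push_cast
    field_simp
    ring
  · have h1 := tanh_le_sub_cube_div hy
    have h2 : (4 * y ^ 3 + 2 * y ^ 5) / (24 * (1 + y ^ 2) ^ 2) ≤ y ^ 3 / (6 * (1 + y ^ 2)) := by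
      rw [div_le_div_iff₀ (by positivity) (by positivity)]
      calc (4 * y ^ 3 + 2 * y ^ 5) * (6 * (1 + y ^ 2))
          ≤ (4 * y ^ 3 + 4 * y ^ 5) * (6 * (1 + y ^ 2)) := by
            gcongr
            norm_num
        _ = y ^ 3 * (24 * (1 + y ^ 2) ^ 2) := by ring
    linarith

/-- A lower bound for `N * coshDefect (N ^ (-1/4) * y)` that does not depend on `N`, with
`s = N ^ (1/4)`. -/
theorem sq_sub_one_le_mul_coshDefect {s : ℝ} (hs : 1 ≤ s) (y : ℝ) :
    (y ^ 2 - 1) / 24 ≤ s ^ 4 * coshDefect (y / s) := by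
  have hs0 : 0 < s := by linarith
  have h1 : 1 ≤ s ^ 2 := one_le_pow₀ hs
  calc (y ^ 2 - 1) / 24 ≤ y ^ 4 / (24 * (1 + y ^ 2)) := by
        -- Clearing denominators leaves `(y² - 1)(y² + 1) ≤ y⁴`.
        rw [div_le_div_iff₀ (by norm_num) (by positivity)]; nlinarith
    _ ≤ y ^ 4 / (24 * (1 + (y / s) ^ 2)) := by
        rw [div_pow]
        gcongr
        exact div_le_self (sq_nonneg y) h1
    _ = s ^ 4 * ((y / s) ^ 4 / (24 * (1 + (y / s) ^ 2))) := by field_simp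
    _ ≤ s ^ 4 * coshDefect (y / s) := by gcongr; exact div_le_coshDefect _

theorem tendsto_mul_coshDefect {s y : ℕ → ℝ} {z : ℝ} (hs : Tendsto s atTop atTop)
    (hy : Tendsto y atTop (𝓝 z)) :
    Tendsto (fun n => s n ^ 4 * coshDefect (y n / s n)) atTop (𝓝 (z ^ 4 / 12)) := by
  have hu : Tendsto (fun n => y n ^ 4 / 12) atTop (𝓝 (z ^ 4 / 12)) := (hy.pow 4).div_const 12
  have hinv : Tendsto (fun n => (s n)⁻¹) atTop (𝓝 0) := hs.inv_tendsto_atTop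
  have hl : Tendsto (fun n => y n ^ 4 / 12 - y n ^ 6 / 45 * (s n)⁻¹ ^ 2) atTop
      (𝓝 (z ^ 4 / 12)) := by
    simpa using hu.sub (((hy.pow 6).div_const 45).mul (hinv.pow 2))
  refine tendsto_of_tendsto_of_tendsto_of_le_of_le' hl hu ?_ ?_
  · filter_upwards [hs.eventually_gt_atTop 0] with n hn
    calc y n ^ 4 / 12 - y n ^ 6 / 45 * (s n)⁻¹ ^ 2
        = s n ^ 4 * ((y n / s n) ^ 4 / 12 - (y n / s n) ^ 6 / 45) := by field_simp
      _ ≤ _ := by gcongr; exact le_coshDefect _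
  · filter_upwards [hs.eventually_gt_atTop 0] with n hn
    calc s n ^ 4 * coshDefect (y n / s n) ≤ s n ^ 4 * ((y n / s n) ^ 4 / 12) := by
          gcongr; exact coshDefect_le _
      _ = y n ^ 4 / 12 := by field_simp

/-! ### Powers of `cos c + i t sin c` -/

/-- The number is `cosh (m + i c) / cosh m` with `t = tanh m`; it lies on an ellipse inside the unit
disc. -/
theorem norm_cos_add_tanh_sin_le_one (c : ℝ) {t : ℝ} (ht : |t| ≤ 1) :
    ‖(Real.cos c + t * Real.sin c * Complex.I : ℂ)‖ ≤ 1 := by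
  have h : (Real.cos c + t * Real.sin c * Complex.I : ℂ)
      = (Real.cos c : ℂ) + ((t * Real.sin c : ℝ) : ℂ) * Complex.I := by push_cast; ring
  rw [h, ← sq_le_one_iff₀ (norm_nonneg _), Complex.sq_norm, Complex.normSq_add_mul_I]
  have h1 : t ^ 2 ≤ 1 := (sq_le_one_iff_abs_le_one t).2 ht
  nlinarith [Real.sin_sq_add_cos_sq c, sq_nonneg (Real.sin c)]

theorem norm_pow_sub_pow_le {z w : ℂ} (hz : ‖z‖ ≤ 1) (hw : ‖w‖ ≤ 1) (n : ℕ) :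
    ‖z ^ n - w ^ n‖ ≤ n * ‖z - w‖ := by
  induction n with
  | zero => simp
  | succ n ih =>
    calc ‖z ^ (n + 1) - w ^ (n + 1)‖ = ‖z * (z ^ n - w ^ n) + (z - w) * w ^ n‖ := by ring_nf
      _ ≤ ‖z‖ * ‖z ^ n - w ^ n‖ + ‖z - w‖ * ‖w‖ ^ n := by
          refine (norm_add_le _ _).trans ?_
          rw [norm_mul, norm_mul, norm_pow]
      _ ≤ 1 * (n * ‖z - w‖) + ‖z - w‖ * 1 := by
          gcongr
          exact pow_le_one₀ (norm_nonneg _) hw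
      _ = _ := by push_cast; ring

/-- Both sides are `1 + i t c - c²/2` up to higher order. The term `t² c²` comes from `‖z‖²`.
Multiplied by `N`, the bound vanishes when `N c²` is bounded and `t, c → 0`. -/
theorem norm_cos_add_tanh_sin_sub_exp_le {c t : ℝ} (hc : |c| ≤ 1 / 2) (ht : |t| ≤ 1) :
    ‖(Real.cos c + t * Real.sin c * Complex.I : ℂ)
        - Complex.exp ((t * c : ℝ) * Complex.I - (c ^ 2 / 2 : ℝ))‖ ≤ c ^ 2 * (t ^ 2 + 2 * |c|) := by
  set z : ℂ := (t * c : ℝ) * Complex.I - (c ^ 2 / 2 : ℝ) with hz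
  have hc0 := abs_nonneg c
  have hc1 : |c| ≤ 1 := by linarith
  have hcc : c ^ 2 = |c| ^ 2 := (sq_abs c).symm
  have htt : t ^ 2 ≤ 1 := (sq_le_one_iff_abs_le_one t).2 ht
  have hcq : |c| ^ 2 ≤ |c| / 2 := by nlinarith
  have hzsq : ‖z‖ ^ 2 = t ^ 2 * c ^ 2 + c ^ 4 / 4 := by
    have : z = ((-(c ^ 2 / 2) : ℝ) : ℂ) + ((t * c : ℝ) : ℂ) * Complex.I := by
      rw [hz]; push_cast; ring
    rw [this, Complex.sq_norm, Complex.normSq_add_mul_I]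
    ring
  have hc4 : c ^ 4 = |c| ^ 2 * |c| ^ 2 := by rw [← hcc]; ring
  have hz1 : ‖z‖ ≤ 1 := by
    rw [← sq_le_one_iff₀ (norm_nonneg _), hzsq, hc4, hcc]
    nlinarith [sq_nonneg |c|]
  have hexp := Complex.norm_exp_sub_one_sub_id_le hz1
  have hcos := Real.cos_bound hc1
  have hsin := Real.sin_bound hc1
  have hsin' : |Real.sin c - c| ≤ |c| ^ 3 := by
    calc |Real.sin c - c| = |(Real.sin c - (c - c ^ 3 / 6)) + -(c ^ 3 / 6)| := by ring_nf
      _ ≤ |c| ^ 5 / 100 + |c| ^ 3 / 6 := by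
          refine (abs_add_le _ _).trans (add_le_add hsin ?_)
          rw [abs_neg, abs_div, abs_pow]; norm_num
      _ ≤ |c| ^ 3 := by nlinarith [pow_nonneg hc0 3, pow_le_one₀ hc0 hc1 (n := 2)]
  have hsplit : (Real.cos c + t * Real.sin c * Complex.I : ℂ) - Complex.exp z
      = ((Real.cos c - (1 - c ^ 2 / 2) : ℝ) : ℂ) + ((t * (Real.sin c - c) : ℝ) : ℂ) * Complex.I
        - (Complex.exp z - 1 - z) := by
    rw [hz]; push_cast; ring
  calc _ ≤ |c| ^ 4 * (5 / 96) + 1 * |c| ^ 3 + ‖z‖ ^ 2 := by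
        rw [hsplit]
        refine (norm_sub_le _ _).trans (add_le_add ((norm_add_le _ _).trans (add_le_add ?_ ?_)) hexp)
        · rwa [Complex.norm_real]
        · rw [norm_mul, Complex.norm_I, mul_one, Complex.norm_real, norm_mul]
          exact mul_le_mul ht hsin' (norm_nonneg _) zero_le_one
    _ ≤ c ^ 2 * (t ^ 2 + 2 * |c|) := by
        rw [hzsq, hc4, hcc]
        nlinarith [pow_nonneg hc0 3, mul_le_mul_of_nonneg_left hcq (sq_nonneg |c|)]

theorem tendsto_cos_add_tanh_sin_pow {N : ℕ → ℕ} {c t : ℕ → ℝ} {κ : ℝ}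
    (hc : Tendsto c atTop (𝓝 0)) (hκ : Tendsto (fun n => N n * c n ^ 2) atTop (𝓝 κ))
    (ht : Tendsto t atTop (𝓝 0)) :
    Tendsto (fun n => (Real.cos (c n) + t n * Real.sin (c n) * Complex.I : ℂ) ^ N n
      - Complex.exp ((N n * (t n * c n) : ℝ) * Complex.I - (N n * c n ^ 2 / 2 : ℝ)))
      atTop (𝓝 0) := by
  have habs : Tendsto (fun n => |c n|) atTop (𝓝 0) := by simpa using hc.abs
  have hbound : Tendsto (fun n => N n * c n ^ 2 * (t n ^ 2 + 2 * |c n|)) atTop (𝓝 0) := by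
    simpa using hκ.mul ((ht.pow 2).add (habs.const_mul 2))
  refine squeeze_zero_norm' ?_ hbound
  have htabs : Tendsto (fun n => |t n|) atTop (𝓝 0) := by simpa using ht.abs
  filter_upwards [habs.eventually_le_const (by norm_num : (0 : ℝ) < 1 / 2),
    htabs.eventually_le_const zero_lt_one] with n hcn htn
  have hexp : Complex.exp ((N n * (t n * c n) : ℝ) * Complex.I - (N n * c n ^ 2 / 2 : ℝ))
      = Complex.exp ((t n * c n : ℝ) * Complex.I - (c n ^ 2 / 2 : ℝ)) ^ N n := by
    rw [← Complex.exp_nat_mul]; congr 1; push_cast; ring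
  have hle : ‖Complex.exp ((t n * c n : ℝ) * Complex.I - (c n ^ 2 / 2 : ℝ))‖ ≤ 1 := by
    rw [Complex.norm_exp, Real.exp_le_one_iff]
    simp only [Complex.sub_re, Complex.mul_re, Complex.ofReal_re, Complex.I_re, Complex.ofReal_im,
      Complex.I_im]
    nlinarith [sq_nonneg (c n)]
  rw [hexp, mul_assoc (N n : ℝ)]
  refine (norm_pow_sub_pow_le (norm_cos_add_tanh_sin_le_one _ htn) hle _).trans ?_
  gcongr
  exact norm_cos_add_tanh_sin_sub_exp_le hcn htn

/-! ### The Gibbs measure and the Hubbard-Stratonovich transform -/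

theorem integral_gibbs {M : ℕ} (N : Fin M → ℕ) (J : Matrix (Fin M) (Fin M) ℝ)
    (f : Config N → ℂ) :
    ∫ x, f x ∂(gibbs N J)
      = (∑ x, (Real.exp (-hamiltonian J x) : ℂ) * f x) / (partitionFunction N J : ℂ) := by
  have hZ := partitionFunction_pos N J
  have hint : ∀ x ∈ (Finset.univ : Finset (Config N)), Integrable f
      (ENNReal.ofReal ((partitionFunction N J)⁻¹ * Real.exp (-hamiltonian J x))
        • Measure.dirac x) := fun x _ =>
    (integrable_dirac (by simp)).smul_measure ENNReal.ofReal_ne_top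
  rw [gibbs, integral_finsetSum_measure hint, Finset.sum_div]
  refine Finset.sum_congr rfl fun x _ => ?_
  rw [integral_smul_measure, integral_dirac, ENNReal.toReal_ofReal (by positivity),
    Complex.real_smul]
  push_cast
  field_simp

theorem sum_config_exp {M : ℕ} (N : Fin M → ℕ) (z : Fin M → ℂ) :
    ∑ x : Config N, Complex.exp (∑ k, z k * magnetisation k x)
      = ∏ k, (2 * Complex.cosh (z k)) ^ N k := by
  have h1 : ∀ k, (2 * Complex.cosh (z k)) ^ N k
      = ∑ y : Fin (N k) → ℤˣ, ∏ i, Complex.exp (z k * ((y i : ℤ) : ℂ)) := by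
    intro k
    have hu : ∑ e : ℤˣ, Complex.exp (z k * ((e : ℤ) : ℂ)) = 2 * Complex.cosh (z k) := by
      rw [show (Finset.univ : Finset ℤˣ) = {1, -1} from rfl,
        Finset.sum_insert (by decide), Finset.sum_singleton, Complex.cosh]
      push_cast
      ring_nf
    have := Finset.prod_univ_sum (fun _ : Fin (N k) => (Finset.univ : Finset ℤˣ))
      (fun _ e => Complex.exp (z k * ((e : ℤ) : ℂ)))
    rw [Fintype.piFinset_univ, Finset.prod_congr rfl (fun _ _ => hu)] at this
    simpa using this
  have h2 := Finset.prod_univ_sum (fun k : Fin M => (Finset.univ : Finset (Fin (N k) → ℤˣ)))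
      (fun k y => ∏ i, Complex.exp (z k * ((y i : ℤ) : ℂ)))
  rw [Fintype.piFinset_univ] at h2
  rw [Finset.prod_congr rfl (fun k _ => h1 k), h2]
  refine Finset.sum_congr rfl fun x _ => ?_
  rw [Complex.exp_sum]
  refine Finset.prod_congr rfl fun k _ => ?_
  rw [← Complex.exp_sum, ← Finset.mul_sum]
  simp [magnetisation, spin]

/-- The coupling matrix `k kᵀ / A + g gᵀ / D`. -/
noncomputable def rankTwoCoupling {M : ℕ} (k g : Fin M → ℝ) (A D : ℝ) :
    Matrix (Fin M) (Fin M) ℝ :=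
  Matrix.of fun i j => k i * k j / A + g i * g j / D

theorem neg_hamiltonian_rankTwoCoupling {M : ℕ} {N : Fin M → ℕ} (k g : Fin M → ℝ) (A D : ℝ)
    (x : Config N) :
    -hamiltonian (rankTwoCoupling k g A D) x
      = (∑ i, k i * magnetisation i x) ^ 2 / (2 * (total N * A))
        + (∑ i, g i * magnetisation i x) ^ 2 / (2 * (total N * D)) := by
  have h : ∀ i j, ∑ a : Fin (N i), ∑ b : Fin (N j), spin x i a * spin x j b
      = magnetisation i x * magnetisation j x := fun i j => by
    rw [magnetisation, magnetisation, Finset.sum_mul_sum]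
  rw [sq, sq, Finset.sum_mul_sum, Finset.sum_mul_sum]
  simp only [hamiltonian, h, rankTwoCoupling, Matrix.of_apply,
    Finset.sum_div, Finset.mul_sum, ← Finset.sum_add_distrib, ← Finset.sum_neg_distrib, neg_mul]
  refine Finset.sum_congr rfl fun i _ => Finset.sum_congr rfl fun j _ => ?_
  simp only [mul_inv, div_eq_mul_inv]
  ring

/-- The integrand of the Hubbard-Stratonovich representation, with `s = N ^ (1/4)`. -/
noncomputable def hsIntegrand {M : ℕ} (N : Fin M → ℕ) (s : ℝ) (k g : Fin M → ℝ) (A D : ℝ)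
    (c : Fin M → ℝ) (p : ℝ × ℝ) : ℂ :=
  (Real.exp (-(s ^ 2 * A / 2) * p.1 ^ 2 + -(D / 2) * p.2 ^ 2) : ℂ) *
    ∏ i, Complex.cosh (((k i * p.1 + g i * p.2 / s) / s : ℝ) + c i * Complex.I) ^ N i

/-- The `+ 0` keeps the exponents in the three-coefficient form of `integral_cexp_quadratic`. -/
theorem integrable_cexp_quadratic_prod {a d : ℝ} (ha : 0 < a) (hd : 0 < d) (b e : ℝ) :
    Integrable (fun p : ℝ × ℝ => Complex.exp (-(a / 2 : ℂ) * p.1 ^ 2 + b * p.1 + 0)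
      * Complex.exp (-(d / 2 : ℂ) * p.2 ^ 2 + e * p.2 + 0)) := by
  have h : ∀ {r : ℝ}, 0 < r → (-(r / 2 : ℂ)).re < 0 := fun {r} hr => by
    have : (-(r / 2 : ℂ)) = ((-(r / 2) : ℝ) : ℂ) := by push_cast; ring
    rw [this, Complex.ofReal_re]; linarith
  exact Integrable.mul_prod (integrable_cexp_quadratic' (h ha) b 0)
    (integrable_cexp_quadratic' (h hd) e 0)

theorem integral_cexp_quadratic_prod {a d : ℝ} (ha : 0 < a) (hd : 0 < d) (b e : ℝ) :
    ∫ p : ℝ × ℝ, Complex.exp (-(a / 2 : ℂ) * p.1 ^ 2 + b * p.1 + 0)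
      * Complex.exp (-(d / 2 : ℂ) * p.2 ^ 2 + e * p.2 + 0)
      = (Real.pi / (a / 2)) ^ (1 / 2 : ℂ) * (Real.pi / (d / 2)) ^ (1 / 2 : ℂ)
        * (Real.exp (b ^ 2 / (2 * a) + e ^ 2 / (2 * d)) : ℂ) := by
  have h : ∀ {r : ℝ}, 0 < r → (-(r / 2 : ℂ)).re < 0 := fun {r} hr => by
    have : (-(r / 2 : ℂ)) = ((-(r / 2) : ℝ) : ℂ) := by push_cast; ring
    rw [this, Complex.ofReal_re]; linarith
  rw [Measure.volume_eq_prod, integral_prod_mul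
    (fun u : ℝ => Complex.exp (-(a / 2 : ℂ) * u ^ 2 + b * u + 0))
    (fun v : ℝ => Complex.exp (-(d / 2 : ℂ) * v ^ 2 + e * v + 0)),
    integral_cexp_quadratic (h ha), integral_cexp_quadratic (h hd)]
  have ha' : (a : ℂ) ≠ 0 := by exact_mod_cast ha.ne'
  have hd' : (d : ℂ) ≠ 0 := by exact_mod_cast hd.ne'
  rw [neg_neg, neg_neg, mul_mul_mul_comm, ← Complex.exp_add]
  push_cast
  congr 2
  field_simp
  ring

theorem hsIntegrand_eq_sum {M : ℕ} (N : Fin M → ℕ) (s : ℝ) (k g : Fin M → ℝ) (A D : ℝ)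
    (c : Fin M → ℝ) (p : ℝ × ℝ) :
    (∏ i, (2 : ℂ) ^ N i) * hsIntegrand N s k g A D c p
      = ∑ x : Config N, Complex.exp (Complex.I * (∑ i, c i * magnetisation i x : ℝ)) *
        (Complex.exp (-(((s ^ 2 * A : ℝ) : ℂ) / 2) * p.1 ^ 2
            + ((∑ i, k i * magnetisation i x) / s : ℝ) * p.1 + 0)
          * Complex.exp (-(D / 2 : ℂ) * p.2 ^ 2
            + ((∑ i, g i * magnetisation i x) / s ^ 2 : ℝ) * p.2 + 0)) := by
  rw [hsIntegrand, mul_left_comm, ← Finset.prod_mul_distrib]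
  simp only [← mul_pow]
  rw [← sum_config_exp, Finset.mul_sum]
  refine Finset.sum_congr rfl fun x _ => ?_
  rw [Complex.ofReal_exp, ← Complex.exp_add, ← Complex.exp_add, ← Complex.exp_add]
  congr 1
  push_cast
  simp only [Finset.mul_sum, Finset.sum_div, add_mul, Finset.sum_add_distrib, Finset.sum_mul,
    add_div]
  have e1 : ∀ i, (k i : ℂ) * p.1 / s * magnetisation i x = k i * magnetisation i x / s * p.1 :=
    fun i => by ring
  have e2 : ∀ i, (g i : ℂ) * p.2 / s / s * magnetisation i x
      = g i * magnetisation i x / s ^ 2 * p.2 := fun i => by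
    rw [div_div, ← sq]; ring
  have e3 : ∀ i, (c i : ℂ) * Complex.I * magnetisation i x
      = Complex.I * (c i * magnetisation i x) := fun i => by ring
  simp only [e1, e2, e3]
  ring

theorem integral_hsIntegrand {M : ℕ} {N : Fin M → ℕ} {s : ℝ} (hs : 0 < s)
    (hsN : s ^ 4 = total N) (k g : Fin M → ℝ) {A D : ℝ} (hA : 0 < A) (hD : 0 < D)
    (c : Fin M → ℝ) :
    (∏ i, (2 : ℂ) ^ N i) * ∫ p, hsIntegrand N s k g A D c p
      = (Real.pi / ((s ^ 2 * A : ℝ) / 2)) ^ (1 / 2 : ℂ) * (Real.pi / (D / 2)) ^ (1 / 2 : ℂ) *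
        ∑ x : Config N, (Real.exp (-hamiltonian (rankTwoCoupling k g A D) x) : ℂ)
          * Complex.exp (Complex.I * (∑ i, c i * magnetisation i x : ℝ)) := by
  have hA' : 0 < s ^ 2 * A := by positivity
  rw [← integral_const_mul]
  simp only [hsIntegrand_eq_sum]
  rw [integral_finsetSum _ fun x _ => (integrable_cexp_quadratic_prod hA' hD _ _).const_mul _,
    Finset.mul_sum]
  refine Finset.sum_congr rfl fun x _ => ?_
  rw [integral_const_mul, integral_cexp_quadratic_prod hA' hD, neg_hamiltonian_rankTwoCoupling,
    ← hsN]
  have e1 : ((∑ i, k i * magnetisation i x) / s) ^ 2 / (2 * (s ^ 2 * A))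
      = (∑ i, k i * magnetisation i x) ^ 2 / (2 * (s ^ 4 * A)) := by field_simp
  have e2 : ((∑ i, g i * magnetisation i x) / s ^ 2) ^ 2 / (2 * D)
      = (∑ i, g i * magnetisation i x) ^ 2 / (2 * (s ^ 4 * D)) := by field_simp
  rw [e1, e2]
  ring

/-- The Gaussian constants and the powers of two occur in both integrals and cancel; `c = 0` yields
the partition function. -/
theorem charFun_map_gibbs {M : ℕ} {N : Fin M → ℕ} {s : ℝ} (hs : 0 < s)
    (hsN : s ^ 4 = total N) (k g : Fin M → ℝ) {A D : ℝ} (hA : 0 < A) (hD : 0 < D)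
    (b : Fin M → ℝ) (t : ℝ) :
    charFun ((gibbs N (rankTwoCoupling k g A D)).map fun x => ∑ i, b i * magnetisation i x) t
      = (∫ p, hsIntegrand N s k g A D (fun i => t * b i) p) /
        ∫ p, hsIntegrand N s k g A D 0 p := by
  have h1 := integral_hsIntegrand hs hsN k g hA hD (fun i => t * b i)
  have h0 := integral_hsIntegrand hs hsN k g hA hD 0
  have hP : (∏ i, (2 : ℂ) ^ N i) ≠ 0 := Finset.prod_ne_zero_iff.2 fun i _ =>
    pow_ne_zero _ two_ne_zero
  have hK : ∀ r : ℝ, 0 < r → ((Real.pi / (r / 2)) ^ (1 / 2 : ℂ) : ℂ) ≠ 0 := fun r hr => by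
    rw [Ne, Complex.cpow_eq_zero_iff, not_and_or]
    left
    have := Real.pi_ne_zero
    have := hr.ne'
    norm_num
    tauto
  have hZ : ∑ x : Config N, (Real.exp (-hamiltonian (rankTwoCoupling k g A D) x) : ℂ)
      * Complex.exp (Complex.I * (∑ i, (0 : Fin M → ℝ) i * magnetisation i x : ℝ))
      = (partitionFunction N (rankTwoCoupling k g A D) : ℂ) := by
    rw [partitionFunction, Complex.ofReal_sum]
    simp
  have hZ0 : (partitionFunction N (rankTwoCoupling k g A D) : ℂ) ≠ 0 := by
    exact_mod_cast (partitionFunction_pos _ _).ne'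
  have hK1 := hK _ (show 0 < s ^ 2 * A by positivity)
  have hK2 := hK D hD
  rw [hZ] at h0
  rw [charFun_apply_real, integral_map (by exact (measurable_of_finite _).aemeasurable)
    (by fun_prop), integral_gibbs,
    ← mul_div_mul_left (∫ p, hsIntegrand N s k g A D (fun i => t * b i) p) _ hP, h1, h0,
    mul_div_mul_left _ _ (mul_ne_zero hK1 hK2)]
  congr 1
  refine Finset.sum_congr rfl fun x _ => ?_
  congr 2
  push_cast
  simp only [Finset.mul_sum, Finset.sum_mul]
  exact Finset.sum_congr rfl fun i _ => by ring

/-! ### Asymptotics in the critical regime -/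

/-- The conditions under which the Hubbard-Stratonovich integrand of the coupling
`k kᵀ / A + g gᵀ / D` converges on the scale `(N ^ (-1/4), N ^ (-1/2))`. -/
structure CriticalScaling {M : ℕ} (α : Fin M → ℝ) (N : ℕ → Fin M → ℕ) (s : ℕ → ℝ)
    (k g : Fin M → ℝ) (A D : ℝ) : Prop where
  pos : ∀ i, 0 < α i
  scale : ∀ n, s n ^ 4 = total (N n)
  tendsto_scale : Tendsto s atTop atTop
  sum_sq : ∑ i, α i * k i ^ 2 = A
  orthogonal : ∑ i, α i * (k i * g i) = 0
  one_add_sum_sq : 1 + ∑ i, α i * g i ^ 2 = D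
  pos_sum_sq : 0 < A
  tendsto_density : ∀ i, Tendsto (fun n => N n i / s n ^ 4) atTop (𝓝 (α i))
  -- The error is relative to the limiting quadratic form, uniformly in `u, v`, so that it serves
  -- both the pointwise limit and the domination.
  density_error : ∃ δ : ℕ → ℝ, Tendsto δ atTop (𝓝 0) ∧ ∀ n u v,
    |s n ^ 2 / 2 * ∑ i, (N n i / s n ^ 4 - α i) * (k i * u + g i * v) ^ 2|
      ≤ δ n * ∑ i, α i * (k i * u + g i * v) ^ 2

/-- The exponent of the Hubbard-Stratonovich integrand. -/
noncomputable def hsExponent {M : ℕ} (α : Fin M → ℝ) (N : Fin M → ℕ) (s : ℝ) (k g : Fin M → ℝ)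
    (p : ℝ × ℝ) : ℝ :=
  -(p.2 ^ 2 / 2) + s ^ 2 / 2 * ∑ i, (N i / s ^ 4 - α i) * (k i * p.1 + g i * (p.2 / s)) ^ 2
    - ∑ i, N i / s ^ 4 * (s ^ 4 * coshDefect ((k i * p.1 + g i * p.2 / s) / s))

theorem hsIntegrand_eq_mul (N : Fin M → ℕ) (s : ℝ) (k g : Fin M → ℝ)
    (A D : ℝ) (c : Fin M → ℝ) (p : ℝ × ℝ) :
    hsIntegrand N s k g A D c p = hsIntegrand N s k g A D 0 p *
      ∏ i, (Real.cos (c i) + Real.tanh ((k i * p.1 + g i * p.2 / s) / s) * Real.sin (c i)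
        * Complex.I : ℂ) ^ N i := by
  simp only [hsIntegrand, mul_assoc, ← Finset.prod_mul_distrib, ← mul_pow]
  congr 1
  refine Finset.prod_congr rfl fun i _ => ?_
  congr 1
  set m := (k i * p.1 + g i * p.2 / s) / s
  have hne : Complex.cosh (m : ℂ) ≠ 0 := by
    rw [← Complex.ofReal_cosh]; exact_mod_cast (Real.cosh_pos m).ne'
  rw [Complex.cosh_add, Complex.cosh_mul_I, Complex.sinh_mul_I, Real.tanh_eq_sinh_div_cosh]
  push_cast
  simp only [Pi.zero_apply, Complex.ofReal_zero, zero_mul, add_zero]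
  field_simp

/-! ### Pointwise limit and uniform bound of the exponent -/

namespace CriticalScaling

variable {M : ℕ} {α : Fin M → ℝ} {N : ℕ → Fin M → ℕ} {s : ℕ → ℝ} {k g : Fin M → ℝ} {A D : ℝ}

theorem sum_mul_sq (h : CriticalScaling α N s k g A D) (u v : ℝ) :
    ∑ i, α i * (k i * u + g i * v) ^ 2 = A * u ^ 2 + (D - 1) * v ^ 2 := by
  have e : ∀ i, α i * (k i * u + g i * v) ^ 2
      = α i * k i ^ 2 * u ^ 2 + 2 * u * v * (α i * (k i * g i)) + α i * g i ^ 2 * v ^ 2 :=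
    fun i => by ring
  simp only [e, Finset.sum_add_distrib, ← Finset.sum_mul, ← Finset.mul_sum, h.sum_sq,
    h.orthogonal, ← h.one_add_sum_sq]
  ring

theorem one_le (h : CriticalScaling α N s k g A D) : 1 ≤ D := by
  rw [← h.one_add_sum_sq]
  have := Finset.sum_nonneg fun i (_ : i ∈ Finset.univ) => mul_nonneg (h.pos i).le (sq_nonneg (g i))
  linarith

/-- The critical cancellation: by `sum_mul_sq` the limiting quadratic form removes the `s² A` term
and reduces `D` to `1`, leaving the density error and the defects. -/
theorem hsIntegrand_zero (h : CriticalScaling α N s k g A D) {n : ℕ} (hn : s n ≠ 0)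
    (p : ℝ × ℝ) :
    hsIntegrand (N n) (s n) k g A D 0 p = (Real.exp (hsExponent α (N n) (s n) k g p) : ℂ) := by
  have hc : ∀ i, Complex.cosh (((k i * p.1 + g i * p.2 / s n) / s n : ℝ)
      + (0 : Fin M → ℝ) i * Complex.I) ^ N n i
      = (Real.exp (N n i * (((k i * p.1 + g i * p.2 / s n) / s n) ^ 2 / 2
        - coshDefect ((k i * p.1 + g i * p.2 / s n) / s n))) : ℂ) := fun i => by
    rw [Real.exp_nat_mul, ← cosh_eq_exp]
    simp
  simp only [hsIntegrand, hc]
  rw [← Complex.ofReal_prod, ← Real.exp_sum, ← Complex.ofReal_mul, ← Real.exp_add]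
  congr 2
  have hs := h.sum_mul_sq p.1 (p.2 / s n)
  rw [hsExponent]
  simp only [sub_mul, mul_sub, Finset.sum_sub_distrib]
  rw [hs]
  have e1 : ∑ i, (N n i : ℝ) * (((k i * p.1 + g i * p.2 / s n) / s n) ^ 2 / 2)
      = s n ^ 2 / 2 * ∑ i, (N n i : ℝ) / s n ^ 4 * (k i * p.1 + g i * (p.2 / s n)) ^ 2 := by
    rw [Finset.mul_sum]
    exact Finset.sum_congr rfl fun i _ => by field_simp
  have e2 : ∀ i, (N n i : ℝ) / s n ^ 4
        * (s n ^ 4 * coshDefect ((k i * p.1 + g i * p.2 / s n) / s n))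
      = N n i * coshDefect ((k i * p.1 + g i * p.2 / s n) / s n) := fun i => by field_simp
  simp only [e1, e2]
  field_simp
  ring

theorem tendsto_shift (h : CriticalScaling α N s k g A D) (p : ℝ × ℝ) (i : Fin M) :
    Tendsto (fun n => k i * p.1 + g i * p.2 / s n) atTop (𝓝 (k i * p.1)) := by
  simpa using (tendsto_const_nhds (x := k i * p.1)).add
    ((tendsto_const_nhds (x := g i * p.2)).div_atTop h.tendsto_scale)

theorem tendsto_hsExponent (h : CriticalScaling α N s k g A D) (p : ℝ × ℝ) :
    Tendsto (fun n => hsExponent α (N n) (s n) k g p) atTop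
      (𝓝 (-(p.2 ^ 2 / 2) - (∑ i, α i * k i ^ 4 / 12) * p.1 ^ 4)) := by
  obtain ⟨δ, hδ, hle⟩ := h.density_error
  have h1 : Tendsto (fun n => s n ^ 2 / 2 *
      ∑ i, (N n i / s n ^ 4 - α i) * (k i * p.1 + g i * (p.2 / s n)) ^ 2) atTop (𝓝 0) := by
    refine squeeze_zero_norm (fun n => hle n p.1 (p.2 / s n)) ?_
    have hz : Tendsto (fun n => p.2 / s n) atTop (𝓝 0) :=
      tendsto_const_nhds.div_atTop h.tendsto_scale
    simp only [h.sum_mul_sq]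
    simpa using hδ.mul ((tendsto_const_nhds (x := A * p.1 ^ 2)).add
      ((hz.pow 2).const_mul (D - 1)))
  have h2 : Tendsto (fun n => ∑ i, N n i / s n ^ 4
      * (s n ^ 4 * coshDefect ((k i * p.1 + g i * p.2 / s n) / s n))) atTop
      (𝓝 (∑ i, α i * ((k i * p.1) ^ 4 / 12))) :=
    tendsto_finsetSum _ fun i _ => (h.tendsto_density i).mul
      (tendsto_mul_coshDefect h.tendsto_scale (h.tendsto_shift p i))
  have h3 := ((tendsto_const_nhds (x := -(p.2 ^ 2 / 2))).add h1).sub h2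
  have e : -(p.2 ^ 2 / 2) - (∑ i, α i * k i ^ 4 / 12) * p.1 ^ 4
      = -(p.2 ^ 2 / 2) + 0 - ∑ i, α i * ((k i * p.1) ^ 4 / 12) := by
    rw [add_zero, Finset.sum_mul]
    congr 1
    exact Finset.sum_congr rfl fun i _ => by ring
  rw [e]
  exact h3

theorem eventually_hsExponent_le (h : CriticalScaling α N s k g A D) :
    ∀ᶠ n in atTop, ∀ p : ℝ × ℝ, hsExponent α (N n) (s n) k g p
      ≤ -(A / 96 * p.1 ^ 2) - p.2 ^ 2 / 2 + (∑ i, α i) / 48 := by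
  obtain ⟨δ, hδ, hle⟩ := h.density_error
  have hdens : ∀ᶠ n in atTop, ∀ i, α i / 2 ≤ N n i / s n ^ 4 :=
    eventually_all.2 fun i => (h.tendsto_density i).eventually_const_le (half_lt_self (h.pos i))
  -- Densities at least `α / 2` and the defect bound with factor `1/24` give a gain of `1/48`; the
  -- density error may consume half of it, leaving `1/96`.
  filter_upwards [hdens, h.tendsto_scale.eventually_ge_atTop 1,
    hδ.eventually_le_const (by norm_num : (0 : ℝ) < 1 / 96)] with n h1 h2 h3 p
  have hsum := h.sum_mul_sq p.1 (p.2 / s n)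
  set y : Fin M → ℝ := fun i => k i * p.1 + g i * (p.2 / s n) with hy
  have hy' : ∀ i, k i * p.1 + g i * p.2 / s n = y i := fun i => by rw [hy]; ring
  have herr : s n ^ 2 / 2 * ∑ i, (N n i / s n ^ 4 - α i) * y i ^ 2
      ≤ 1 / 96 * ∑ i, α i * y i ^ 2 :=
    (le_abs_self _).trans ((hle n p.1 (p.2 / s n)).trans (mul_le_mul_of_nonneg_right h3
      (Finset.sum_nonneg fun i _ => mul_nonneg (h.pos i).le (sq_nonneg _))))
  have hdef : 1 / 48 * ∑ i, α i * y i ^ 2 - (∑ i, α i) / 48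
      ≤ ∑ i, N n i / s n ^ 4 * (s n ^ 4 * coshDefect (y i / s n)) := by
    rw [Finset.mul_sum, Finset.sum_div, ← Finset.sum_sub_distrib]
    refine Finset.sum_le_sum fun i _ => ?_
    have hd := sq_sub_one_le_mul_coshDefect h2 (y i)
    have hd0 : 0 ≤ s n ^ 4 * coshDefect (y i / s n) :=
      mul_nonneg (by positivity) (le_trans (by positivity) (div_le_coshDefect _))
    calc 1 / 48 * (α i * y i ^ 2) - α i / 48 = α i / 2 * ((y i ^ 2 - 1) / 24) := by ring
      _ ≤ α i / 2 * (s n ^ 4 * coshDefect (y i / s n)) :=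
          mul_le_mul_of_nonneg_left hd (half_pos (h.pos i)).le
      _ ≤ _ := mul_le_mul_of_nonneg_right (h1 i) hd0
  have hD := mul_nonneg (sub_nonneg.2 h.one_le) (sq_nonneg (p.2 / s n))
  simp only [hsExponent, hy']
  linarith

end CriticalScaling

/-- The limit of the Hubbard-Stratonovich integrand. -/
noncomputable def hsLimit (Q κ p q : ℝ) (x : ℝ × ℝ) : ℂ :=
  (Real.exp (-(x.2 ^ 2 / 2) - Q * x.1 ^ 4) : ℂ) *
    (Complex.exp (-(κ / 2 : ℝ)) * Complex.exp ((x.1 * p + x.2 * q : ℝ) * Complex.I))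

theorem charFun_quarticLaw (η t : ℝ) :
    charFun (quarticLaw η) t
      = (∫ u : ℝ, (Real.exp (-(η * u ^ 4)) : ℂ) * Complex.exp ((u * t : ℝ) * Complex.I))
        / ∫ u : ℝ, (Real.exp (-(η * u ^ 4)) : ℂ) := by
  rw [charFun_apply_real, quarticLaw, integral_tilted, integral_complex_ofReal,
    ← integral_div]
  refine integral_congr_ae (Eventually.of_forall fun u => ?_)
  simp only [Complex.real_smul]
  push_cast
  rw [mul_comm (t : ℂ) u]
  ring

theorem integral_exp_neg_half_sq_mul_cexp (q : ℝ) :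
    ∫ v : ℝ, (Real.exp (-(v ^ 2 / 2)) : ℂ) * Complex.exp ((v * q : ℝ) * Complex.I)
      = (Real.pi / (1 / 2)) ^ (1 / 2 : ℂ) * Complex.exp (-(q ^ 2 / 2 : ℝ)) := by
  have h := integral_cexp_quadratic (b := -(1 / 2 : ℂ)) (by norm_num) (q * Complex.I) 0
  rw [neg_neg] at h
  have e : (0 : ℂ) - (q * Complex.I) ^ 2 / (4 * -(1 / 2)) = -(q ^ 2 / 2 : ℝ) := by
    rw [mul_pow, Complex.I_sq]; push_cast; ring
  rw [e] at h
  rw [← h]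
  refine integral_congr_ae (Eventually.of_forall fun v => ?_)
  simp only
  rw [Complex.ofReal_exp, ← Complex.exp_add]
  congr 1
  push_cast
  ring

theorem integral_hsLimit (Q κ p q : ℝ) :
    ∫ x, hsLimit Q κ p q x
      = Complex.exp (-(κ / 2 : ℝ)) *
        ((∫ u : ℝ, (Real.exp (-(Q * u ^ 4)) : ℂ) * Complex.exp ((u * p : ℝ) * Complex.I))
          * ((Real.pi / (1 / 2)) ^ (1 / 2 : ℂ) * Complex.exp (-(q ^ 2 / 2 : ℝ)))) := by
  rw [← integral_exp_neg_half_sq_mul_cexp, ← integral_prod_mul, ← integral_const_mul,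
    Measure.volume_eq_prod]
  refine integral_congr_ae (Eventually.of_forall fun x => ?_)
  simp only [hsLimit]
  rw [sub_eq_add_neg, Real.exp_add, Complex.ofReal_mul, Complex.ofReal_add, add_mul,
    Complex.exp_add]
  ring

theorem integral_hsLimit_div {Q : ℝ} (hQ : 0 < Q) (κ p q : ℝ) :
    (∫ x, hsLimit Q κ p q x) / ∫ x, hsLimit Q 0 0 0 x
      = Complex.exp (-((κ + q ^ 2) / 2 : ℝ)) * charFun (quarticLaw Q) p := by
  -- If this integral vanished, division by zero would make the characteristic function `0` at the
  -- origin, where it is `1`.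
  have hne : (∫ u : ℝ, (Real.exp (-(Q * u ^ 4)) : ℂ)) ≠ 0 := by
    intro h0
    have := isProbabilityMeasure_quarticLaw hQ
    have h1 := charFun_zero (quarticLaw Q)
    rw [charFun_quarticLaw, h0, div_zero] at h1
    simp at h1
  have hK : ((Real.pi / (1 / 2)) ^ (1 / 2 : ℂ) : ℂ) ≠ 0 := by
    rw [Ne, Complex.cpow_eq_zero_iff, not_and_or]
    left
    have := Real.pi_ne_zero
    norm_num
  have e : Complex.exp (-((κ + q ^ 2) / 2 : ℝ))
      = Complex.exp (-(κ / 2 : ℝ)) * Complex.exp (-(q ^ 2 / 2 : ℝ)) := by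
    rw [← Complex.exp_add]; congr 1; push_cast; ring
  rw [integral_hsLimit, integral_hsLimit, charFun_quarticLaw, e]
  simp only [mul_zero, Complex.ofReal_zero, zero_mul, Complex.exp_zero, mul_one, zero_div,
    neg_zero, one_mul, ne_eq, OfNat.ofNat_ne_zero, not_false_eq_true, zero_pow]
  generalize (∫ u : ℝ, (Real.exp (-(Q * u ^ 4)) : ℂ) * Complex.exp ((u * p : ℝ) * Complex.I)) = X
  field_simp

/-- Convergence in law from convergence of characteristic functions. -/
theorem convergesInLaw_of_tendsto_charFun {M : ℕ} {N : ℕ → Fin M → ℕ}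
    {J : Matrix (Fin M) (Fin M) ℝ} {X : (n : ℕ) → Config (N n) → ℝ} {ν : Measure ℝ}
    (hν : IsProbabilityMeasure ν)
    (h : ∀ t : ℝ, Tendsto (fun n => charFun ((gibbs (N n) J).map (X n)) t) atTop
      (𝓝 (charFun ν t))) :
    ConvergesInLaw (fun n => gibbs (N n) J) X ν := by
  refine ⟨hν, ⟨fun n => (measurable_of_finite _).aemeasurable, by fun_prop, ?_⟩⟩
  refine ProbabilityMeasure.tendsto_of_tendsto_charFun fun t => ?_
  change Tendsto (fun n => charFun ((gibbs (N n) J).map (X n)) t) atTop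
    (𝓝 (charFun (ν.map id) t))
  rw [Measure.map_id]
  exact h t

/-! ### Limits of the integrals and of the characteristic functions -/

namespace CriticalScaling

variable {M : ℕ} {α : Fin M → ℝ} {N : ℕ → Fin M → ℕ} {s : ℕ → ℝ} {k g : Fin M → ℝ} {A D : ℝ}

theorem tendsto_zero_of_tendsto_mul_sq (h : CriticalScaling α N s k g A D) {i : Fin M}
    {c : ℕ → ℝ} {κ : ℝ} (hκ : Tendsto (fun n => N n i * c n ^ 2) atTop (𝓝 κ)) :
    Tendsto c atTop (𝓝 0) := by
  have hs4 : Tendsto (fun n => (s n ^ 4)⁻¹) atTop (𝓝 0) :=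
    ((tendsto_pow_atTop (by norm_num)).comp h.tendsto_scale).inv_tendsto_atTop
  have h2 : Tendsto (fun n => N n i * c n ^ 2 / (N n i / s n ^ 4) * (s n ^ 4)⁻¹) atTop (𝓝 0) := by
    simpa using (hκ.div (h.tendsto_density i) (h.pos i).ne').mul hs4
  have h3 : Tendsto (fun n => c n ^ 2) atTop (𝓝 0) := by
    refine h2.congr' ?_
    filter_upwards [(h.tendsto_density i).eventually_const_lt (h.pos i),
      h.tendsto_scale.eventually_gt_atTop 0] with n hn hs
    have : (N n i : ℝ) ≠ 0 := by rintro h0; rw [h0, zero_div] at hn; exact lt_irrefl _ hn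
    field_simp
  have h4 : Tendsto (fun n => |c n|) atTop (𝓝 0) := by
    have := (Real.continuous_sqrt.tendsto 0).comp h3
    simpa [Function.comp_def, Real.sqrt_sq_eq_abs] using this
  exact (tendsto_zero_iff_abs_tendsto_zero _).2 h4

theorem tendsto_shift_div (h : CriticalScaling α N s k g A D) (x : ℝ × ℝ) (i : Fin M) :
    Tendsto (fun n => (k i * x.1 + g i * x.2 / s n) / s n) atTop (𝓝 0) :=
  (h.tendsto_shift x i).div_atTop h.tendsto_scale

theorem tendsto_tanh_shift (h : CriticalScaling α N s k g A D) (x : ℝ × ℝ) (i : Fin M) :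
    Tendsto (fun n => Real.tanh ((k i * x.1 + g i * x.2 / s n) / s n)) atTop (𝓝 0) := by
  simpa [Function.comp_def] using (continuous_tanh.tendsto 0).comp (h.tendsto_shift_div x i)

/-- The error of `tanh m ≈ m` is of order `s⁻³`, while `N |c|` is of order `s²`. -/
theorem tendsto_phase_error (h : CriticalScaling α N s k g A D) {c : ℕ → ℝ} {κ : ℝ}
    {i : Fin M} (hκ : Tendsto (fun n => N n i * c n ^ 2) atTop (𝓝 κ)) (x : ℝ × ℝ) :
    Tendsto (fun n => N n i * c n * (Real.tanh ((k i * x.1 + g i * x.2 / s n) / s n)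
      - (k i * x.1 + g i * x.2 / s n) / s n)) atTop (𝓝 0) := by
  have hb : Tendsto (fun n => √(N n i / s n ^ 4 * (N n i * c n ^ 2))
      * (|k i * x.1 + g i * x.2 / s n| ^ 3 / 3) * (s n)⁻¹) atTop (𝓝 0) := by
    have h1 := (Real.continuous_sqrt.tendsto _).comp ((h.tendsto_density i).mul hκ)
    have h2 := ((h.tendsto_shift x i).abs.pow 3).div_const 3
    simpa using (h1.mul h2).mul h.tendsto_scale.inv_tendsto_atTop
  refine squeeze_zero_norm' ?_ hb
  filter_upwards [h.tendsto_scale.eventually_gt_atTop 0] with n hs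
  have e : √(N n i / s n ^ 4 * (N n i * c n ^ 2)) = N n i * |c n| / s n ^ 2 := by
    rw [← Real.sqrt_sq (show 0 ≤ N n i * |c n| / s n ^ 2 by positivity)]
    congr 1
    rw [div_pow, mul_pow, sq_abs]
    field_simp
  rw [e, norm_mul, norm_mul, Real.norm_eq_abs, Real.norm_eq_abs, Real.norm_eq_abs, Nat.abs_cast]
  refine (mul_le_mul_of_nonneg_left (abs_tanh_sub_self_le _) (by positivity)).trans_eq ?_
  rw [abs_div, abs_of_pos hs]
  field_simp

theorem tendsto_phase (h : CriticalScaling α N s k g A D) {c : ℕ → Fin M → ℝ} {κ : Fin M → ℝ}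
    {p q : ℝ} (hκ : ∀ i, Tendsto (fun n => N n i * c n i ^ 2) atTop (𝓝 (κ i)))
    (hp : Tendsto (fun n => ∑ i, N n i * c n i * k i / s n) atTop (𝓝 p))
    (hq : Tendsto (fun n => ∑ i, N n i * c n i * g i / s n ^ 2) atTop (𝓝 q)) (x : ℝ × ℝ) :
    Tendsto (fun n => ∑ i, N n i * (Real.tanh ((k i * x.1 + g i * x.2 / s n) / s n) * c n i))
      atTop (𝓝 (x.1 * p + x.2 * q)) := by
  have h1 := ((hp.const_mul x.1).add (hq.const_mul x.2)).add
    (tendsto_finsetSum Finset.univ fun i _ => h.tendsto_phase_error (hκ i) x)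
  rw [Finset.sum_const_zero, add_zero] at h1
  refine h1.congr fun n => ?_
  rw [Finset.mul_sum, Finset.mul_sum, ← Finset.sum_add_distrib, ← Finset.sum_add_distrib]
  refine Finset.sum_congr rfl fun i _ => ?_
  simp only [add_div, div_div, ← sq]
  ring

theorem tendsto_hsIntegrand (h : CriticalScaling α N s k g A D) {c : ℕ → Fin M → ℝ}
    {κ : Fin M → ℝ} {p q : ℝ}
    (hκ : ∀ i, Tendsto (fun n => N n i * c n i ^ 2) atTop (𝓝 (κ i)))
    (hp : Tendsto (fun n => ∑ i, N n i * c n i * k i / s n) atTop (𝓝 p))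
    (hq : Tendsto (fun n => ∑ i, N n i * c n i * g i / s n ^ 2) atTop (𝓝 q)) (x : ℝ × ℝ) :
    Tendsto (fun n => hsIntegrand (N n) (s n) k g A D (c n) x) atTop
      (𝓝 (hsLimit (∑ i, α i * k i ^ 4 / 12) (∑ i, κ i) p q x)) := by
  set t : ℕ → Fin M → ℝ := fun n i => Real.tanh ((k i * x.1 + g i * x.2 / s n) / s n) with ht
  set a : ℕ → Fin M → ℂ := fun n i =>
    (Real.cos (c n i) + t n i * Real.sin (c n i) * Complex.I : ℂ) ^ N n i with ha
  have hphase := h.tendsto_phase hκ hp hq x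
  -- The phase of a single group may diverge like `s`; only the sum over the groups converges. Each
  -- factor is therefore stripped of its phase, and the total phase is restored after taking the
  -- product.
  have hfac : ∀ i, Tendsto
      (fun n => a n i * Complex.exp (-((N n i * (t n i * c n i) : ℝ) * Complex.I))) atTop
      (𝓝 (Complex.exp (-(κ i / 2 : ℝ)))) := by
    intro i
    have h1 := tendsto_cos_add_tanh_sin_pow (N := fun n => N n i)
      (h.tendsto_zero_of_tendsto_mul_sq (hκ i)) (hκ i) (h.tendsto_tanh_shift x i)
    have h2 : Tendsto (fun n => Complex.exp (-(N n i * c n i ^ 2 / 2 : ℝ))) atTop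
        (𝓝 (Complex.exp (-(κ i / 2 : ℝ)))) :=
      (Complex.continuous_exp.tendsto _).comp
        ((Complex.continuous_ofReal.tendsto _).comp ((hκ i).div_const 2)).neg
    have h3 : Tendsto (fun n => a n i * Complex.exp (-((N n i * (t n i * c n i) : ℝ) * Complex.I))
        - Complex.exp (-(N n i * c n i ^ 2 / 2 : ℝ))) atTop (𝓝 0) := by
      rw [tendsto_zero_iff_norm_tendsto_zero] at h1 ⊢
      refine h1.congr fun n => ?_
      have hn : ‖Complex.exp (-((N n i * (t n i * c n i) : ℝ) * Complex.I))‖ = 1 := by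
        rw [← neg_mul, ← Complex.ofReal_neg, Complex.norm_exp_ofReal_mul_I]
      rw [← mul_one ‖_ - _‖, ← hn, ← norm_mul, sub_mul, ← Complex.exp_add]
      congr 3
      change ((N n i * (t n i * c n i) : ℝ) : ℂ) * Complex.I - ((N n i * c n i ^ 2 / 2 : ℝ) : ℂ)
        + -(((N n i * (t n i * c n i) : ℝ) : ℂ) * Complex.I) = _
      ring
    simpa using h3.add h2
  have hprod := tendsto_finsetProd Finset.univ fun i _ => hfac i
  have hphase' : Tendsto (fun n => Complex.exp ((∑ i, N n i * (t n i * c n i) : ℝ) * Complex.I))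
      atTop (𝓝 (Complex.exp ((x.1 * p + x.2 * q : ℝ) * Complex.I))) :=
    (Complex.continuous_exp.tendsto _).comp
      (((Complex.continuous_ofReal.tendsto _).comp hphase).mul_const Complex.I)
  have hexp : Tendsto (fun n => (Real.exp (hsExponent α (N n) (s n) k g x) : ℂ)) atTop
      (𝓝 (Real.exp (-(x.2 ^ 2 / 2) - (∑ i, α i * k i ^ 4 / 12) * x.1 ^ 4) : ℂ)) :=
    (Complex.continuous_ofReal.tendsto _).comp
      ((Real.continuous_exp.tendsto _).comp (h.tendsto_hsExponent x))
  have hall := hexp.mul (hprod.mul hphase')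
  rw [← Complex.exp_sum] at hall
  have hlim : hsLimit (∑ i, α i * k i ^ 4 / 12) (∑ i, κ i) p q x
      = (Real.exp (-(x.2 ^ 2 / 2) - (∑ i, α i * k i ^ 4 / 12) * x.1 ^ 4) : ℂ) *
        (Complex.exp (∑ i, -((κ i / 2 : ℝ) : ℂ))
          * Complex.exp ((x.1 * p + x.2 * q : ℝ) * Complex.I)) := by
    rw [hsLimit, Finset.sum_neg_distrib, ← Complex.ofReal_sum, Finset.sum_div]
  rw [hlim]
  refine hall.congr' ?_
  filter_upwards [h.tendsto_scale.eventually_ne_atTop 0] with n hn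
  rw [hsIntegrand_eq_mul, h.hsIntegrand_zero hn]
  congr 1
  rw [Finset.prod_mul_distrib, mul_assoc, ← Complex.exp_sum, ← Complex.exp_add]
  have : ∑ i, -((N n i * (t n i * c n i) : ℝ) * Complex.I : ℂ)
      + (∑ i, N n i * (t n i * c n i) : ℝ) * Complex.I = 0 := by
    rw [Finset.sum_neg_distrib, ← Finset.sum_mul, ← Complex.ofReal_sum, neg_add_cancel]
  rw [this, Complex.exp_zero, mul_one]

theorem norm_hsIntegrand_le (h : CriticalScaling α N s k g A D) {n : ℕ} (hn : s n ≠ 0)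
    (c : Fin M → ℝ) (x : ℝ × ℝ) :
    ‖hsIntegrand (N n) (s n) k g A D c x‖ ≤ Real.exp (hsExponent α (N n) (s n) k g x) := by
  rw [hsIntegrand_eq_mul, h.hsIntegrand_zero hn, norm_mul, Complex.norm_real,
    Real.norm_of_nonneg (Real.exp_pos _).le]
  refine mul_le_of_le_one_right (Real.exp_pos _).le ?_
  rw [norm_prod]
  refine Finset.prod_le_one (fun i _ => norm_nonneg _) fun i _ => ?_
  rw [norm_pow]
  exact pow_le_one₀ (norm_nonneg _) (norm_cos_add_tanh_sin_le_one _ (Real.abs_tanh_lt_one _).le)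

theorem tendsto_integral_hsIntegrand (h : CriticalScaling α N s k g A D) {c : ℕ → Fin M → ℝ}
    {κ : Fin M → ℝ} {p q : ℝ}
    (hκ : ∀ i, Tendsto (fun n => N n i * c n i ^ 2) atTop (𝓝 (κ i)))
    (hp : Tendsto (fun n => ∑ i, N n i * c n i * k i / s n) atTop (𝓝 p))
    (hq : Tendsto (fun n => ∑ i, N n i * c n i * g i / s n ^ 2) atTop (𝓝 q)) :
    Tendsto (fun n => ∫ x, hsIntegrand (N n) (s n) k g A D (c n) x) atTop
      (𝓝 (∫ x, hsLimit (∑ i, α i * k i ^ 4 / 12) (∑ i, κ i) p q x)) := by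
  have hA := h.pos_sum_sq
  refine tendsto_integral_filter_of_dominated_convergence
    (fun x : ℝ × ℝ => Real.exp (-(A / 96) * x.1 ^ 2)
      * (Real.exp (-(1 / 2) * x.2 ^ 2) * Real.exp ((∑ i, α i) / 48))) ?_ ?_ ?_ ?_
  · refine Eventually.of_forall fun n => Continuous.aestronglyMeasurable ?_
    unfold hsIntegrand
    fun_prop
  · filter_upwards [h.eventually_hsExponent_le, h.tendsto_scale.eventually_ne_atTop 0] with n hn hs
    refine Eventually.of_forall fun x => (h.norm_hsIntegrand_le hs _ x).trans ?_
    rw [← Real.exp_add, ← Real.exp_add]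
    exact Real.exp_le_exp.2 ((hn x).trans_eq (by ring))
  · exact Integrable.mul_prod (integrable_exp_neg_mul_sq (by positivity))
      ((integrable_exp_neg_mul_sq (by norm_num)).mul_const _)
  · exact Eventually.of_forall fun x => h.tendsto_hsIntegrand hκ hp hq x

theorem sum_pow_four_pos (h : CriticalScaling α N s k g A D) :
    0 < ∑ i, α i * k i ^ 4 / 12 := by
  have hA := h.pos_sum_sq
  rw [← h.sum_sq] at hA
  obtain ⟨i, -, hi⟩ := Finset.exists_lt_of_sum_lt (f := fun _ : Fin M => (0 : ℝ)) (by simpa using hA)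
  have hk : k i ≠ 0 := by rintro h0; simp [h0] at hi
  have hα := h.pos
  refine Finset.sum_pos' (fun j _ => ?_) ⟨i, Finset.mem_univ i, ?_⟩
  · have := hα j
    positivity
  · have := hα i
    positivity

/-- The limit of the characteristic functions of linear combinations of the magnetisations. -/
theorem tendsto_charFun (h : CriticalScaling α N s k g A D) {b : ℕ → Fin M → ℝ}
    {κ : Fin M → ℝ} {p q : ℝ}
    (hκ : ∀ i, Tendsto (fun n => N n i * b n i ^ 2) atTop (𝓝 (κ i)))
    (hp : Tendsto (fun n => ∑ i, N n i * b n i * k i / s n) atTop (𝓝 p))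
    (hq : Tendsto (fun n => ∑ i, N n i * b n i * g i / s n ^ 2) atTop (𝓝 q)) (t : ℝ) :
    Tendsto (fun n => charFun ((gibbs (N n) (rankTwoCoupling k g A D)).map
        fun x => ∑ i, b n i * magnetisation i x) t) atTop
      (𝓝 (Complex.exp (-(t ^ 2 * (∑ i, κ i + q ^ 2) / 2 : ℝ))
        * charFun (quarticLaw (∑ i, α i * k i ^ 4 / 12)) (t * p))) := by
  have hnum := h.tendsto_integral_hsIntegrand (c := fun n i => t * b n i)
    (κ := fun i => t ^ 2 * κ i) (p := t * p) (q := t * q)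
    (fun i => ((hκ i).const_mul (t ^ 2)).congr fun n => by ring)
    ((hp.const_mul t).congr fun n => by
      rw [Finset.mul_sum]; exact Finset.sum_congr rfl fun i _ => by ring)
    ((hq.const_mul t).congr fun n => by
      rw [Finset.mul_sum]; exact Finset.sum_congr rfl fun i _ => by ring)
  have hden := h.tendsto_integral_hsIntegrand (c := 0) (κ := 0) (p := 0) (q := 0)
    (by simp) (by simp) (by simp)
  have hQ := h.sum_pow_four_pos
  have hne : ∫ x, hsLimit (∑ i, α i * k i ^ 4 / 12) 0 0 0 x ≠ 0 := by
    intro h0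
    have := isProbabilityMeasure_quarticLaw hQ
    have h1 := integral_hsLimit_div hQ 0 0 0
    rw [h0, div_zero, charFun_zero] at h1
    simp at h1
  simp only [Pi.zero_apply, Finset.sum_const_zero] at hden
  have := hnum.div hden hne
  rw [integral_hsLimit_div hQ, ← Finset.mul_sum, mul_pow, ← mul_add] at this
  refine this.congr' ?_
  filter_upwards [h.tendsto_scale.eventually_gt_atTop 0] with n hs
  rw [charFun_map_gibbs hs (h.scale n) k g h.pos_sum_sq (zero_lt_one.trans_le h.one_le)]
  rfl

/-- Normal fluctuations, transversally to the critical direction. -/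
theorem convergesInLaw_gaussianReal (h : CriticalScaling α N s k g A D) {b : ℕ → Fin M → ℝ}
    {κ : Fin M → ℝ} {q v : ℝ}
    (hκ : ∀ i, Tendsto (fun n => N n i * b n i ^ 2) atTop (𝓝 (κ i)))
    (hp : Tendsto (fun n => ∑ i, N n i * b n i * k i / s n) atTop (𝓝 0))
    (hq : Tendsto (fun n => ∑ i, N n i * b n i * g i / s n ^ 2) atTop (𝓝 q))
    (hv : ∑ i, κ i + q ^ 2 = v) :
    ConvergesInLaw (fun n => gibbs (N n) (rankTwoCoupling k g A D))
      (fun n x => ∑ i, b n i * magnetisation i x) (gaussianReal 0 v.toNNReal) := by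
  refine convergesInLaw_of_tendsto_charFun inferInstance fun t => ?_
  have hprob := isProbabilityMeasure_quarticLaw h.sum_pow_four_pos
  have hv0 : 0 ≤ v := hv ▸ add_nonneg (Finset.sum_nonneg fun i _ =>
    ge_of_tendsto' (hκ i) fun n => by positivity) (sq_nonneg q)
  convert h.tendsto_charFun hκ hp hq t using 2
  rw [charFun_gaussianReal, mul_zero, charFun_zero, hv, Real.coe_toNNReal _ hv0]
  simp
  ring_nf

/-- Quartic fluctuations along the critical direction. -/
theorem convergesInLaw_quarticLaw (h : CriticalScaling α N s k g A D) {b : ℕ → Fin M → ℝ}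
    {η : ℝ} (hκ : ∀ i, Tendsto (fun n => N n i * b n i ^ 2) atTop (𝓝 0))
    (hp : Tendsto (fun n => ∑ i, N n i * b n i * k i / s n) atTop (𝓝 1))
    (hq : Tendsto (fun n => ∑ i, N n i * b n i * g i / s n ^ 2) atTop (𝓝 0))
    (hη : ∑ i, α i * k i ^ 4 / 12 = η) :
    ConvergesInLaw (fun n => gibbs (N n) (rankTwoCoupling k g A D))
      (fun n x => ∑ i, b n i * magnetisation i x) (quarticLaw η) := by
  refine convergesInLaw_of_tendsto_charFun
    (isProbabilityMeasure_quarticLaw (hη ▸ h.sum_pow_four_pos)) fun t => ?_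
  have := h.tendsto_charFun (κ := 0) hκ hp hq t
  simpa [hη] using this

end CriticalScaling

/-! ### Group densities, the scale, and the homogeneous model -/

theorem pos_of_tendsto_density {M : ℕ} {α : Fin M → ℝ} (hα : ∀ i, α i ≠ 0)
    {N : ℕ → Fin M → ℕ}
    (hNα : ∀ i, Tendsto (fun n => (N n i : ℝ) / (total (N n) : ℝ)) atTop (𝓝 (α i)))
    (i : Fin M) : 0 < α i :=
  lt_of_le_of_ne (ge_of_tendsto' (hNα i) fun n => by positivity) (hα i).symm

theorem tendsto_total {M : ℕ} {N : ℕ → Fin M → ℕ} {i : Fin M}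
    (hN : Tendsto (fun n => N n i) atTop atTop) :
    Tendsto (fun n => (total (N n) : ℝ)) atTop atTop :=
  tendsto_natCast_atTop_atTop.comp (tendsto_atTop_mono
    (fun n => Finset.single_le_sum (f := N n) (fun _ _ => Nat.zero_le _) (Finset.mem_univ i)) hN)

theorem sum_density {M : ℕ} {N : Fin M → ℕ} (h : (total N : ℝ) ≠ 0) :
    ∑ i, (N i : ℝ) / (total N : ℝ) = 1 := by
  rw [← Finset.sum_div, ← Nat.cast_sum]
  exact div_self h

theorem sum_eq_one_of_tendsto_density {M : ℕ} {α : Fin M → ℝ} {N : ℕ → Fin M → ℕ}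
    (hT : Tendsto (fun n => (total (N n) : ℝ)) atTop atTop)
    (hNα : ∀ i, Tendsto (fun n => (N n i : ℝ) / (total (N n) : ℝ)) atTop (𝓝 (α i))) :
    ∑ i, α i = 1 := by
  refine tendsto_nhds_unique (tendsto_finsetSum Finset.univ fun i _ => hNα i)
    (tendsto_const_nhds.congr' ?_)
  filter_upwards [hT.eventually_ne_atTop 0] with n hn
  rw [sum_density hn]

/-- The scale `N ^ (1/4)`. -/
noncomputable def scale {M : ℕ} (N : Fin M → ℕ) : ℝ := (total N : ℝ) ^ (1 / 4 : ℝ)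

theorem scale_pow_four {M : ℕ} (N : Fin M → ℕ) : scale N ^ 4 = total N := by
  rw [scale, ← Real.rpow_natCast, ← Real.rpow_mul (Nat.cast_nonneg _)]
  norm_num

theorem scale_sq {M : ℕ} (N : Fin M → ℕ) : scale N ^ 2 = √(total N : ℝ) := by
  rw [← scale_pow_four, show scale N ^ 4 = (scale N ^ 2) ^ 2 by ring, Real.sqrt_sq (sq_nonneg _)]

theorem tendsto_scale {M : ℕ} {N : ℕ → Fin M → ℕ}
    (hT : Tendsto (fun n => (total (N n) : ℝ)) atTop atTop) :
    Tendsto (fun n => scale (N n)) atTop atTop :=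
  (tendsto_rpow_atTop (by norm_num)).comp hT

/-- The critical scaling of the homogeneous model. -/
theorem criticalScaling_homogeneous {M : ℕ} {α : Fin M → ℝ} {N : ℕ → Fin M → ℕ}
    (hα : ∀ i, 0 < α i) (hT : Tendsto (fun n => (total (N n) : ℝ)) atTop atTop)
    (hNα : ∀ i, Tendsto (fun n => (N n i : ℝ) / (total (N n) : ℝ)) atTop (𝓝 (α i))) :
    CriticalScaling α N (fun n => scale (N n)) 1 0 1 1 := by
  have h1 := sum_eq_one_of_tendsto_density hT hNα
  refine ⟨hα, fun n => scale_pow_four _, tendsto_scale hT, by simpa using h1, by simp, by simp,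
    one_pos, by simpa only [scale_pow_four] using hNα, 0, tendsto_const_nhds, fun n u v => ?_⟩
  -- With no spins the prefactor `scale ^ 2` is zero; otherwise the density errors sum to exactly
  -- zero. Hence `δ = 0`, without any rate.
  rcases eq_or_ne (total (N n) : ℝ) 0 with h0 | h0
  · have : scale (N n) ^ 2 = 0 := by rw [scale_sq, h0, Real.sqrt_zero]
    simp [this]
  · rw [scale_pow_four]
    have : ∑ i, ((N n i : ℝ) / total (N n) - α i)
        * ((1 : Fin M → ℝ) i * u + (0 : Fin M → ℝ) i * v) ^ 2 = 0 := by
      simp only [Pi.one_apply, Pi.zero_apply, ← Finset.sum_mul, Finset.sum_sub_distrib,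
        sum_density h0, h1, sub_self, zero_mul]
    rw [this]
    simp

theorem rankTwoCoupling_one_zero (M : ℕ) :
    rankTwoCoupling (1 : Fin M → ℝ) 0 1 1 = homogeneousCoupling M 1 := by
  ext i j; simp [rankTwoCoupling, homogeneousCoupling]

/-! ### Fluctuations with explicit normalisations -/

namespace CriticalScaling

variable {M : ℕ} {α : Fin M → ℝ} {N : ℕ → Fin M → ℕ} {s : ℕ → ℝ} {k g : Fin M → ℝ} {A D : ℝ}

/-- The weight of group `i` is asymptotic to `β i / (α i s³)`, so that `p = ∑ β k`, while `N b²` is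
of order `s⁻²` and the `g`-sum of order `s⁻¹`. -/
theorem convergesInLaw_quarticLaw_of_sum (h : CriticalScaling α N s k g A D) {β : Fin M → ℝ}
    {η : ℝ} (hβ : ∑ i, β i * k i = 1) (hη : ∑ i, α i * k i ^ 4 / 12 = η) :
    ConvergesInLaw (fun n => gibbs (N n) (rankTwoCoupling k g A D))
      (fun n x => ∑ i, β i / (α i * (N n i : ℝ) ^ 3) ^ (1 / 4 : ℝ) * magnetisation i x)
      (quarticLaw η) := by
  have hinv : Tendsto (fun n => (s n)⁻¹) atTop (𝓝 0) := h.tendsto_scale.inv_tendsto_atTop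
  have hroot : ∀ i, Tendsto (fun n => (α i * (N n i / s n ^ 4) ^ 3) ^ (1 / 4 : ℝ)) atTop
      (𝓝 (α i)) := fun i => by
    have h1 := (((h.tendsto_density i).pow 3).const_mul (α i)).rpow_const (p := 1 / 4)
      (Or.inr (by norm_num))
    have e : (α i * α i ^ 3) ^ (1 / 4 : ℝ) = α i := by
      rw [show α i * α i ^ 3 = α i ^ (4 : ℕ) by ring, ← Real.rpow_natCast,
        ← Real.rpow_mul (h.pos i).le]
      norm_num
    rwa [e] at h1
  have hb : ∀ n i, 0 < s n → (α i * (N n i : ℝ) ^ 3) ^ (1 / 4 : ℝ)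
      = (α i * (N n i / s n ^ 4) ^ 3) ^ (1 / 4 : ℝ) * s n ^ 3 := fun n i hs => by
    have e : s n ^ 3 = ((s n ^ 3) ^ (4 : ℕ)) ^ (1 / 4 : ℝ) := by
      rw [← Real.rpow_natCast (s n ^ 3), ← Real.rpow_mul (by positivity)]
      norm_num
    have hα := (h.pos i).le
    rw [e, ← Real.mul_rpow (by positivity) (by positivity)]
    congr 1
    field_simp
  have hlin : ∀ i (γ : ℝ), Tendsto (fun n => N n i / s n ^ 4 * β i
      / (α i * (N n i / s n ^ 4) ^ 3) ^ (1 / 4 : ℝ) * γ) atTop (𝓝 (β i * γ)) := fun i γ => by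
    have := (((h.tendsto_density i).mul_const (β i)).div (hroot i) (h.pos i).ne').mul_const γ
    rwa [mul_div_cancel_left₀ _ (h.pos i).ne'] at this
  refine h.convergesInLaw_quarticLaw (fun i => ?_) ?_ ?_ hη
  · have h1 := (((hlin i (β i)).div (hroot i) (h.pos i).ne')).mul (hinv.pow 2)
    rw [zero_pow two_ne_zero, mul_zero] at h1
    refine h1.congr' ?_
    filter_upwards [h.tendsto_scale.eventually_gt_atTop 0] with n hs
    rw [hb n i hs, Pi.div_apply]
    field_simp
  · rw [show 𝓝 (1 : ℝ) = 𝓝 (∑ i, β i * k i) by rw [hβ]]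
    refine tendsto_finsetSum _ fun i _ => (hlin i (k i)).congr' ?_
    filter_upwards [h.tendsto_scale.eventually_gt_atTop 0] with n hs
    rw [hb n i hs]
    field_simp
  · rw [show (0 : ℝ) = ∑ i, β i * g i * 0 by simp]
    refine tendsto_finsetSum _ fun i _ => ((hlin i (g i)).mul hinv).congr' ?_
    filter_upwards [h.tendsto_scale.eventually_gt_atTop 0] with n hs
    rw [hb n i hs]
    field_simp

/-- Normal fluctuations with the normalisation `√N`. -/
theorem convergesInLaw_gaussianReal_of_sqrt_total (h : CriticalScaling α N s k g A D)
    {β : Fin M → ℝ} {v : ℝ}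
    (hrate : ∀ i, Tendsto (fun n => s n * (N n i / s n ^ 4 - α i)) atTop (𝓝 0))
    (hk : ∑ i, α i * β i * k i = 0)
    (hv : ∑ i, α i * β i ^ 2 + (∑ i, α i * β i * g i) ^ 2 = v) :
    ConvergesInLaw (fun n => gibbs (N n) (rankTwoCoupling k g A D))
      (fun n x => ∑ i, β i / s n ^ 2 * magnetisation i x) (gaussianReal 0 v.toNNReal) := by
  refine h.convergesInLaw_gaussianReal (fun i => ?_) ?_ ?_ hv
  · refine ((h.tendsto_density i).mul_const (β i ^ 2)).congr' ?_
    filter_upwards [h.tendsto_scale.eventually_gt_atTop 0] with n hs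
    field_simp
  · rw [show (0 : ℝ) = ∑ i, 0 * (β i * k i) by simp]
    refine (tendsto_finsetSum _ fun i _ => (hrate i).mul_const (β i * k i)).congr' ?_
    filter_upwards [h.tendsto_scale.eventually_gt_atTop 0] with n hs
    -- The sum defining `p` has size `s`; subtracting `s` times the vanishing sum `hk` leaves
    -- density errors times `s`, which the rate controls.
    calc ∑ i, s n * (N n i / s n ^ 4 - α i) * (β i * k i)
        = ∑ i, N n i * (β i / s n ^ 2) * k i / s n - s n * ∑ i, α i * β i * k i := by
          rw [Finset.mul_sum, ← Finset.sum_sub_distrib]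
          refine Finset.sum_congr rfl fun i _ => ?_
          field_simp
      _ = _ := by rw [hk, mul_zero, sub_zero]
  · refine tendsto_finsetSum _ fun i _ => (((h.tendsto_density i).mul_const
      (β i)).mul_const (g i)).congr' ?_
    filter_upwards [h.tendsto_scale.eventually_gt_atTop 0] with n hs
    field_simp

/-- Normal fluctuations with the normalisation `√(α i * N i)`. -/
theorem convergesInLaw_gaussianReal_of_sqrt_mul (h : CriticalScaling α N s k g A D)
    {β : Fin M → ℝ} {v : ℝ}
    (hrate : ∀ i, Tendsto (fun n => s n * (N n i / s n ^ 4 - α i)) atTop (𝓝 0))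
    (hk : ∑ i, β i * k i = 0)
    (hv : ∑ i, β i ^ 2 / α i + (∑ i, β i * g i) ^ 2 = v) :
    ConvergesInLaw (fun n => gibbs (N n) (rankTwoCoupling k g A D))
      (fun n x => ∑ i, β i / √(α i * N n i) * magnetisation i x)
      (gaussianReal 0 v.toNNReal) := by
  have hpos : ∀ i, ∀ᶠ n in atTop, 0 < s n ∧ (0 : ℝ) < N n i := fun i => by
    filter_upwards [(h.tendsto_density i).eventually_const_lt (h.pos i),
      h.tendsto_scale.eventually_gt_atTop 0] with n hn hs
    refine ⟨hs, ?_⟩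
    by_contra h0
    have : (N n i : ℝ) = 0 := le_antisymm (not_lt.1 h0) (Nat.cast_nonneg _)
    simp [this] at hn
  have hsqrt : ∀ n i, 0 < s n → (0 : ℝ) < N n i →
      N n i / √(α i * N n i) = √(N n i / s n ^ 4 / α i) * s n ^ 2 := fun n i hs hN => by
    have hα := h.pos i
    rw [div_eq_iff (by positivity), ← Real.sqrt_sq (show 0 ≤ s n ^ 2 by positivity),
      ← Real.sqrt_mul (by positivity), ← Real.sqrt_mul (by positivity)]
    rw [eq_comm, Real.sqrt_eq_iff_mul_self_eq_of_pos hN]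
    field_simp
  have hratio : ∀ i, Tendsto (fun n => √(N n i / s n ^ 4 / α i)) atTop (𝓝 1) := fun i => by
    have := (Real.continuous_sqrt.tendsto _).comp ((h.tendsto_density i).div_const (α i))
    rwa [div_self (h.pos i).ne', Real.sqrt_one] at this
  -- `|√r - 1| ≤ |r - 1|` transfers the rate to the square root.
  have hratio' : ∀ i, Tendsto (fun n => (√(N n i / s n ^ 4 / α i) - 1) * s n) atTop (𝓝 0) := by
    intro i
    have hb : Tendsto (fun n => |s n * (N n i / s n ^ 4 - α i)| / α i) atTop (𝓝 0) := by
      simpa using (hrate i).abs.div_const (α i)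
    refine squeeze_zero_norm' ?_ hb
    filter_upwards [hpos i] with n hn
    obtain ⟨hs, hN⟩ := hn
    have hα := h.pos i
    set r := (N n i : ℝ) / s n ^ 4 / α i with hr
    have hr0 : 0 ≤ r := by positivity
    have e : s n * (N n i / s n ^ 4 - α i) / α i = s n * (r - 1) := by rw [hr]; field_simp
    rw [← abs_of_pos hα, ← abs_div, abs_of_pos hα, e, Real.norm_eq_abs, abs_mul, abs_mul,
      mul_comm]
    refine mul_le_mul_of_nonneg_left ?_ (abs_nonneg _)
    have e2 : r - 1 = (√r - 1) * (√r + 1) := by nlinarith [Real.mul_self_sqrt hr0]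
    rw [e2, abs_mul]
    refine le_mul_of_one_le_right (abs_nonneg _) ?_
    rw [abs_of_nonneg (by positivity)]
    linarith [Real.sqrt_nonneg r]
  refine h.convergesInLaw_gaussianReal (fun i => ?_) ?_ ?_ hv
  · refine tendsto_const_nhds.congr' ?_
    filter_upwards [hpos i] with n hn
    have hα := h.pos i
    have hN := hn.2
    rw [div_pow, Real.sq_sqrt (by positivity)]
    field_simp
  · rw [show (0 : ℝ) = ∑ i, 0 * (β i * k i) by simp]
    refine (tendsto_finsetSum _ fun i _ => (hratio' i).mul_const (β i * k i)).congr' ?_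
    filter_upwards [eventually_all.2 hpos, h.tendsto_scale.eventually_gt_atTop 0] with n hn hs
    calc ∑ i, (√(N n i / s n ^ 4 / α i) - 1) * s n * (β i * k i)
        = ∑ i, N n i * (β i / √(α i * N n i)) * k i / s n - s n * ∑ i, β i * k i := by
          rw [Finset.mul_sum, ← Finset.sum_sub_distrib]
          refine Finset.sum_congr rfl fun i _ => ?_
          rw [mul_div_left_comm, hsqrt n i (hn i).1 (hn i).2]
          field_simp
      _ = _ := by rw [hk, mul_zero, sub_zero]
  · refine tendsto_finsetSum _ fun i _ => ?_
    have := (hratio i).mul_const (β i * g i)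
    rw [one_mul] at this
    refine this.congr' ?_
    filter_upwards [hpos i] with n hn
    have hs := hn.1
    rw [mul_div_left_comm, hsqrt n i hs hn.2]
    field_simp

end CriticalScaling

/-! ### Two groups with heterogeneous coupling -/

/-- The critical direction of `J⁻¹ = diag α + h hᵀ`, with `h = (x, -σ y)`. -/
noncomputable def criticalDirection (x y σ : ℝ) : Fin 2 → ℝ := ![1 / (2 * x), σ / (2 * y)]

/-- The direction that is `α`-orthogonal to the critical one and dual to `h = (x, -σ y)`. -/
noncomputable def transversalDirection (α : Fin 2 → ℝ) (x y σ : ℝ) : Fin 2 → ℝ :=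
  ![α 1 * x / (x ^ 2 * α 1 + y ^ 2 * α 0), -(σ * α 0 * y) / (x ^ 2 * α 1 + y ^ 2 * α 0)]

/-- The supremum of the relative errors is bounded by their sum, which tends to zero when `r =
N^(1/4)` and the densities converge at rate `√N`. -/
theorem abs_density_error_le {M : ℕ} {α : Fin M → ℝ} (hα : ∀ i, 0 < α i)
    {ρ : Fin M → ℝ} (r : ℝ) (y : Fin M → ℝ) :
    |r ^ 2 / 2 * ∑ i, (ρ i - α i) * y i ^ 2|
      ≤ (∑ i, r ^ 2 * |ρ i - α i| / (2 * α i)) * ∑ i, α i * y i ^ 2 := by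
  rw [Finset.mul_sum, Finset.mul_sum]
  refine (Finset.abs_sum_le_sum_abs _ _).trans (Finset.sum_le_sum fun i _ => ?_)
  have h0 := hα i
  calc |r ^ 2 / 2 * ((ρ i - α i) * y i ^ 2)|
      = r ^ 2 * |ρ i - α i| / (2 * α i) * (α i * y i ^ 2) := by
        rw [abs_mul, abs_mul, abs_of_nonneg (by positivity : 0 ≤ r ^ 2 / 2),
          abs_of_nonneg (sq_nonneg (y i))]
        field_simp
    _ ≤ _ := by
        gcongr
        exact Finset.single_le_sum (f := fun i => r ^ 2 * |ρ i - α i| / (2 * α i))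
          (fun j _ => by have := hα j; positivity) (Finset.mem_univ i)

/-- The critical scaling of the heterogeneous model with two groups. -/
theorem criticalScaling_heterogeneous {α : Fin 2 → ℝ} {N : ℕ → Fin 2 → ℕ}
    (hα : ∀ i, 0 < α i) (hT : Tendsto (fun n => (total (N n) : ℝ)) atTop atTop)
    (hNα : ∀ i, Tendsto (fun n => (N n i : ℝ) / (total (N n) : ℝ)) atTop (𝓝 (α i)))
    (hrate : ∀ i, Tendsto (fun n => √(total (N n) : ℝ) *
      ((N n i : ℝ) / (total (N n) : ℝ) - α i)) atTop (𝓝 0))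
    {x y σ : ℝ} (hx : 0 < x) (hy : 0 < y) (hσ : σ ^ 2 = 1) :
    CriticalScaling α N (fun n => scale (N n)) (criticalDirection x y σ)
      (transversalDirection α x y σ)
      ((x ^ 2 * α 1 + y ^ 2 * α 0) / (4 * x ^ 2 * y ^ 2))
      (1 + α 0 * α 1 / (x ^ 2 * α 1 + y ^ 2 * α 0)) := by
  have h0 := hα 0
  have h1 := hα 1
  refine ⟨hα, fun n => scale_pow_four _, tendsto_scale hT, ?_, ?_, ?_, by positivity,
    by simpa only [scale_pow_four] using hNα,
    fun n => ∑ i, scale (N n) ^ 2 * |N n i / scale (N n) ^ 4 - α i| / (2 * α i), ?_,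
    fun n u v => abs_density_error_le hα _ _⟩
  · simp only [criticalDirection, Fin.sum_univ_two, Matrix.cons_val_zero, Matrix.cons_val_one,
      div_pow, mul_pow, hσ]
    field_simp
    ring
  · simp only [criticalDirection, transversalDirection, Fin.sum_univ_two, Matrix.cons_val_zero,
      Matrix.cons_val_one]
    field_simp
    linear_combination -(α 0 * α 1) * hσ
  · simp only [transversalDirection, Fin.sum_univ_two, Matrix.cons_val_zero,
      Matrix.cons_val_one, div_pow, mul_pow, neg_sq, hσ]
    field_simp
  · rw [show (0 : ℝ) = ∑ i : Fin 2, |(0 : ℝ)| / (2 * α i) by simp]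
    refine tendsto_finsetSum _ fun i _ => ((hrate i).abs.div_const (2 * α i)).congr fun n => ?_
    rw [scale_pow_four, ← scale_sq, abs_mul, abs_of_nonneg (sq_nonneg _)]

/-- The structure of the inverse coupling matrix in the critical regime. -/
theorem HeterogeneousCritical.inv_eq {α : Fin 2 → ℝ} {J : Matrix (Fin 2) (Fin 2) ℝ}
    (hα : ∀ i, 0 < α i) (hJ : HeterogeneousCritical α J) (hL : ∀ k, 0 < J⁻¹ k k - α k) :
    Real.sign (J 0 1) ^ 2 = 1 ∧
      J⁻¹ 0 1 = -(Real.sign (J 0 1) * √(J⁻¹ 0 0 - α 0) * √(J⁻¹ 1 1 - α 1)) ∧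
      J⁻¹ 1 0 = -(Real.sign (J 0 1) * √(J⁻¹ 0 0 - α 0) * √(J⁻¹ 1 1 - α 1)) := by
  -- A positive semi-definite matrix that is not definite is singular; this fixes the off-diagonal
  -- entry up to sign.
  have hdet : (J⁻¹ - Matrix.diagonal α).det = 0 := by
    by_contra h
    exact hJ.not_posDef (hJ.posSemidef.posDef_iff_det_ne_zero.2 h)
  have hsymm : J⁻¹ 1 0 = J⁻¹ 0 1 := by
    have := hJ.posDef.inv.isHermitian.apply 0 1
    simpa using this
  simp only [Matrix.det_fin_two, Matrix.sub_apply, Matrix.diagonal_apply_eq] at hdet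
  simp only [Matrix.diagonal_apply_ne _ (show (0 : Fin 2) ≠ 1 by decide),
    Matrix.diagonal_apply_ne _ (show (1 : Fin 2) ≠ 0 by decide), sub_zero, hsymm] at hdet
  have hunit : IsUnit J.det := hJ.posDef.det_pos.ne'.isUnit
  -- As the diagonal entries are positive, this shows that `J⁻¹ 0 1` and `J 0 1` have opposite
  -- signs.
  have hmul : J⁻¹ 0 0 * J 0 1 + J⁻¹ 0 1 * J 1 1 = 0 := by
    have := congrFun (congrFun (Matrix.nonsing_inv_mul J hunit) 0) 1
    simpa [Matrix.mul_apply, Fin.sum_univ_two] using this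
  have hJ11 : 0 < J 1 1 := hJ.posDef.diag_pos
  have hL0 := hL 0
  have hL1 := hL 1
  have hI00 : 0 < J⁻¹ 0 0 := by linarith [hα 0]
  have hab : √(J⁻¹ 0 0 - α 0) * √(J⁻¹ 1 1 - α 1) = |J⁻¹ 0 1| := by
    rw [← Real.sqrt_mul hL0.le, ← Real.sqrt_mul_self_eq_abs]
    congr 1
    linarith
  have hne : J⁻¹ 0 1 ≠ 0 := by
    intro h0
    rw [h0] at hdet
    nlinarith [mul_pos hL0 hL1]
  rw [hsymm, mul_assoc, hab, and_self]
  rcases lt_or_gt_of_ne hne with hlt | hgt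
  · have : 0 < J 0 1 := by
      by_contra hn
      nlinarith [mul_neg_of_neg_of_pos hlt hJ11, mul_nonneg hI00.le (sub_nonneg.2 (not_lt.1 hn))]
    rw [Real.sign_of_pos this, abs_of_neg hlt]
    norm_num
  · have : J 0 1 < 0 := by
      by_contra hn
      nlinarith [mul_pos hgt hJ11, mul_nonneg hI00.le (not_lt.1 hn)]
    rw [Real.sign_of_neg this, abs_of_pos hgt]
    norm_num

/-- With `h = (x, -σ y)`, `h · k = 0` and `h · g = 1` give `J⁻¹ k = diag α k` and `J⁻¹ g = D h`.
Both matrices thus send `diag α k` to `k` and `h` to `g / D`. The proof checks this in coordinates,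
against the inverse. -/
theorem HeterogeneousCritical.eq_rankTwoCoupling {α : Fin 2 → ℝ}
    {J : Matrix (Fin 2) (Fin 2) ℝ}
    (hα : ∀ i, 0 < α i) (hJ : HeterogeneousCritical α J) {x y σ : ℝ} (hx : 0 < x) (hy : 0 < y)
    (hσ : σ ^ 2 = 1) (h00 : J⁻¹ 0 0 - α 0 = x ^ 2) (h11 : J⁻¹ 1 1 - α 1 = y ^ 2)
    (h01 : J⁻¹ 0 1 = -(σ * x * y)) (h10 : J⁻¹ 1 0 = -(σ * x * y)) :
    rankTwoCoupling (criticalDirection x y σ) (transversalDirection α x y σ)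
      ((x ^ 2 * α 1 + y ^ 2 * α 0) / (4 * x ^ 2 * y ^ 2))
      (1 + α 0 * α 1 / (x ^ 2 * α 1 + y ^ 2 * α 0)) = J := by
  have hunit : IsUnit J.det := hJ.posDef.det_pos.ne'.isUnit
  have h0 := hα 0
  have h1 := hα 1
  have hD : 1 + α 0 * α 1 / (x ^ 2 * α 1 + y ^ 2 * α 0)
      = (x ^ 2 * α 1 + y ^ 2 * α 0 + α 0 * α 1) / (x ^ 2 * α 1 + y ^ 2 * α 0) := by field_simp
  have hE : rankTwoCoupling (criticalDirection x y σ) (transversalDirection α x y σ)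
      ((x ^ 2 * α 1 + y ^ 2 * α 0) / (4 * x ^ 2 * y ^ 2))
      (1 + α 0 * α 1 / (x ^ 2 * α 1 + y ^ 2 * α 0))
      = (x ^ 2 * α 1 + y ^ 2 * α 0 + α 0 * α 1)⁻¹
        • !![y ^ 2 + α 1, σ * x * y; σ * x * y, x ^ 2 + α 0] := by
    rw [hD]
    ext i j
    fin_cases i <;> fin_cases j <;>
      simp [rankTwoCoupling, criticalDirection, transversalDirection] <;> field_simp <;>
      grind
  rw [← Matrix.nonsing_inv_nonsing_inv J hunit, eq_comm]
  refine Matrix.inv_eq_right_inv ?_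
  have hJi : J⁻¹ = !![x ^ 2 + α 0, -(σ * x * y); -(σ * x * y), y ^ 2 + α 1] := by
    ext i j
    fin_cases i <;> fin_cases j <;> simp [h01, h10] <;> linarith
  rw [hE, hJi]
  ext i j
  fin_cases i <;> fin_cases j <;> simp [Matrix.mul_apply, Fin.sum_univ_two] <;> field_simp <;>
    grind

end CurieWeiss

/-! ### The four limit theorems -/

theorem mainTheorem5 (α : Fin 2 → ℝ) (hα : ∀ k, α k ≠ 0)
    (N : ℕ → Fin 2 → ℕ)
    (hN : ∀ k, Tendsto (fun n => N n k) atTop atTop)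
    (hNα : ∀ k, Tendsto (fun n => (N n k : ℝ) / (CurieWeiss.total (N n) : ℝ)) atTop (𝓝 (α k))) :
    -- homogeneous coupling, difference
    ((∀ k, Tendsto (fun n => (CurieWeiss.total (N n) : ℝ) ^ (1 / 4 : ℝ) *
          ((N n k : ℝ) / (CurieWeiss.total (N n) : ℝ) - α k)) atTop (𝓝 0)) →
      CurieWeiss.ConvergesInLaw
        (fun n => CurieWeiss.gibbs (N n) (CurieWeiss.homogeneousCoupling 2 1))
        (fun n x =>
          (√(α 1 / α 0) * CurieWeiss.magnetisation 0 x
            - √(α 0 / α 1) * CurieWeiss.magnetisation 1 x) / √(CurieWeiss.total (N n) : ℝ))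
        (gaussianReal 0 1)) ∧
    -- homogeneous coupling, sum
    CurieWeiss.ConvergesInLaw
      (fun n => CurieWeiss.gibbs (N n) (CurieWeiss.homogeneousCoupling 2 1))
      (fun n x =>
        CurieWeiss.magnetisation 0 x / (2 * (α 0 * (N n 0 : ℝ) ^ 3) ^ (1 / 4 : ℝ))
          + CurieWeiss.magnetisation 1 x / (2 * (α 1 * (N n 1 : ℝ) ^ 3) ^ (1 / 4 : ℝ)))
      (CurieWeiss.quarticLaw (1 / 12)) ∧
    -- heterogeneous coupling
    ((∀ k, Tendsto (fun n => √(CurieWeiss.total (N n) : ℝ) *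
          ((N n k : ℝ) / (CurieWeiss.total (N n) : ℝ) - α k)) atTop (𝓝 0)) →
      ∀ J : Matrix (Fin 2) (Fin 2) ℝ, CurieWeiss.HeterogeneousCritical α J →
        (∀ k, 0 < J⁻¹ k k - α k) →
        -- difference
        CurieWeiss.ConvergesInLaw (fun n => CurieWeiss.gibbs (N n) J)
          (fun n x =>
            √(J⁻¹ 0 0 - α 0) / √(α 0 * (N n 0 : ℝ)) * CurieWeiss.magnetisation 0 x
              - Real.sign (J 0 1) *
                (√(J⁻¹ 1 1 - α 1) / √(α 1 * (N n 1 : ℝ)) * CurieWeiss.magnetisation 1 x))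
          (gaussianReal 0
            (1 + (J⁻¹ 0 0 - α 0) / α 0 + (J⁻¹ 1 1 - α 1) / α 1).toNNReal) ∧
        -- sum
        CurieWeiss.ConvergesInLaw (fun n => CurieWeiss.gibbs (N n) J)
          (fun n x =>
            √(J⁻¹ 0 0 - α 0) / (α 0 * (N n 0 : ℝ) ^ 3) ^ (1 / 4 : ℝ)
                * CurieWeiss.magnetisation 0 x
              + Real.sign (J 0 1) *
                (√(J⁻¹ 1 1 - α 1) / (α 1 * (N n 1 : ℝ) ^ 3) ^ (1 / 4 : ℝ)
                  * CurieWeiss.magnetisation 1 x))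
          (CurieWeiss.quarticLaw (1 / (2 ^ 6 * 3) *
            (α 0 / (J⁻¹ 0 0 - α 0) ^ 2 + α 1 / (J⁻¹ 1 1 - α 1) ^ 2)))) := by
  open CurieWeiss in
  have hpos := pos_of_tendsto_density hα hNα
  have hT := tendsto_total (hN 0)
  have hhom := criticalScaling_homogeneous hpos hT hNα
  have hsum := sum_eq_one_of_tendsto_density hT hNα
  have h0 := hpos 0
  have h1 := hpos 1
  rw [Fin.sum_univ_two] at hsum
  refine ⟨fun hrate => ?_, ?_, fun hrate J hJ hL => ?_⟩
  -- With `e1`, this makes the weights of the difference `α`-orthogonal to `k = 1`.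
  · have e0 : α 0 * √(α 1 / α 0) = √(α 0 * α 1) := by
      rw [← Real.sqrt_sq h0.le, ← Real.sqrt_mul (sq_nonneg _), Real.sqrt_sq h0.le]
      congr 1
      field_simp
    have e1 : α 1 * √(α 0 / α 1) = √(α 0 * α 1) := by
      rw [← Real.sqrt_sq h1.le, ← Real.sqrt_mul (sq_nonneg _), Real.sqrt_sq h1.le]
      congr 1
      field_simp
    have := hhom.convergesInLaw_gaussianReal_of_sqrt_total (β := ![√(α 1 / α 0), -√(α 0 / α 1)])
      (v := 1) (fun i => by simp only [scale_pow_four]; exact hrate i)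
      (by simp [Fin.sum_univ_two, e0, e1])
      (by
        simp only [Fin.sum_univ_two, Matrix.cons_val_zero, Matrix.cons_val_one, neg_sq,
          Pi.zero_apply, mul_zero, add_zero]
        rw [Real.sq_sqrt (by positivity), Real.sq_sqrt (by positivity)]
        field_simp
        linarith)
    rw [rankTwoCoupling_one_zero, Real.toNNReal_one] at this
    convert this using 4 with n x
    rw [Fin.sum_univ_two, scale_sq]
    simp only [Matrix.cons_val_zero, Matrix.cons_val_one]
    ring
  · have := hhom.convergesInLaw_quarticLaw_of_sum (β := fun _ => 1 / 2) (η := 1 / 12)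
      (by simp) (by simp [Fin.sum_univ_two]; linarith)
    rw [rankTwoCoupling_one_zero] at this
    convert this using 4 with n x
    rw [Fin.sum_univ_two]
    ring
  · obtain ⟨hσ, h01, h10⟩ := hJ.inv_eq hpos hL
    have hx := Real.sqrt_pos.2 (hL 0)
    have hy := Real.sqrt_pos.2 (hL 1)
    have h00 := (Real.sq_sqrt (hL 0).le).symm
    have h11 := (Real.sq_sqrt (hL 1).le).symm
    have hJeq := hJ.eq_rankTwoCoupling hpos hx hy hσ h00 h11 h01 h10
    generalize Real.sign (J 0 1) = σ at *
    generalize √(J⁻¹ 0 0 - α 0) = x at *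
    generalize √(J⁻¹ 1 1 - α 1) = y at *
    rw [h00, h11]
    have hcrit := criticalScaling_heterogeneous hpos hT hNα hrate hx hy hσ
    have hinv : Tendsto (fun n => (scale (N n))⁻¹) atTop (𝓝 0) :=
      (tendsto_scale hT).inv_tendsto_atTop
    constructor
    -- The weights are `h` itself: `h · k = 0` removes the quartic part, and `h · g = 1` contributes
    -- the summand `1` of the variance.
    · have := hcrit.convergesInLaw_gaussianReal_of_sqrt_mul (β := ![x, -(σ * y)])
        (v := 1 + x ^ 2 / α 0 + y ^ 2 / α 1)
        (fun i => by
          -- Dividing the rate `√N` by `s` gives the weaker rate `N^(1/4)`.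
          have h2 := (hrate i).mul hinv
          rw [zero_mul] at h2
          refine h2.congr' ?_
          filter_upwards [(tendsto_scale hT).eventually_gt_atTop 0] with n hs
          rw [scale_pow_four, ← scale_sq]
          field_simp)
        (by
          simp only [criticalDirection, Fin.sum_univ_two, Matrix.cons_val_zero,
            Matrix.cons_val_one]
          field_simp
          linear_combination (-1 : ℝ) * hσ)
        (by
          have e : x * (α 1 * x / (x ^ 2 * α 1 + y ^ 2 * α 0))
              + -(σ * y) * (-(σ * α 0 * y) / (x ^ 2 * α 1 + y ^ 2 * α 0)) = 1 := by
            field_simp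
            rw [hσ]
            ring
          simp only [transversalDirection, Fin.sum_univ_two, Matrix.cons_val_zero,
            Matrix.cons_val_one, neg_sq, mul_pow, hσ]
          rw [e]
          ring)
      rw [hJeq] at this
      convert this using 4 with n z
      rw [Fin.sum_univ_two]
      simp only [Matrix.cons_val_zero, Matrix.cons_val_one]
      ring
    -- The halves in `k` make `β · k = 1/2 + σ²/2 = 1`; their fourth power gives `2⁶ · 3 = 2⁴ · 12`.
    · have := hcrit.convergesInLaw_quarticLaw_of_sum (β := ![x, σ * y])
        (η := 1 / (2 ^ 6 * 3) * (α 0 / (x ^ 2) ^ 2 + α 1 / (y ^ 2) ^ 2))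
        (by
          simp only [criticalDirection, Fin.sum_univ_two, Matrix.cons_val_zero,
            Matrix.cons_val_one]
          field_simp
          linear_combination hσ)
        (by
          have hσ4 : σ ^ 4 = 1 := by rw [show σ ^ 4 = (σ ^ 2) ^ 2 by ring, hσ, one_pow]
          simp only [criticalDirection, Fin.sum_univ_two, Matrix.cons_val_zero,
            Matrix.cons_val_one, div_pow, mul_pow, hσ4]
          field_simp
          ring)
      rw [hJeq] at this
      convert this using 4 with n z
      rw [Fin.sum_univ_two]
      simp only [Matrix.cons_val_zero, Matrix.cons_val_one]
      ring
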